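/- Let $\mathcal F=\{f_i\colon I_i\to\mathbb R\}_{i=1}^n$ be a finite family of continuous strictly monotone functions, where $I_i=[c_i^\ell,c_i^r]$ with $c_i^\ell<c_i^r$; the points $c_i^\ell,c_i^r$ are called turning points. For a word $g=a_{i_1}\cdots a_{i_m}$ of length $|g|=m$ in the symbols $a_1,\dots,a_n$ put $f_g=f_{i_m}\circ\cdots\circ f_{i_1}$, with its natural domain $\mathrm{Dom}(f_g)\subset\mathbb R$, and for $J\subset\mathbb R$ write $f_{a_i}(J)=f_i(J\cap I_i)$. For $J\subset\mathbb R$, $x\in\mathbb R$, a turning point $c$ and $m\ge 1$, define $$\ell(m|J)=\#\{g: |g|=m,\ \mathrm{int}(\mathrm{Dom}(f_g)\cap J)\ne\emptyset\},\qquad \ell(m)=\ell(m|\mathbb R),$$ $$\ell_x(m)=\#\{g: |g|=m,\ x\in\mathrm{int}(\mathrm{Dom}(f_g))\},$$ $$\ell'_c(m)=\#\{g: |g|=m,\ \mathrm{int}(\mathrm{Dom}(f_g))\neq\emptyset,\ c\in \mathrm{Dom}(f_g)\cap\partial\,\mathrm{Dom}(f_g)\},$$ and $$s=\limsup_{m\to\infty}\ell(m)^{1/m},\qquad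 s_0=\max_{c}\limsup_{m\to\infty}\ell'_c(m)^{1/m},\qquad L(J)(t)=\sum_{m\ge1}\ell(m|J)\,t^{m-1},\qquad L=L(\mathbb R),$$ where $c$ runs over the turning points. Let $\mathfrak A=\{x\in\mathbb R:\limsup_{m\to\infty}\frac1m\log\ell_x(m)<\log s\}$ (with $\log 0=-\infty$), let $\mathscr A$ be the collection of all finite unions of intervals of the forms $(-\infty,x)$, $(-\infty,x]$, $(x,y)$, $[x,y)$, $(x,y]$, $[x,y]$, $[x,+\infty)$, $(x,+\infty)$ with $x,y\in\mathfrak A$, and let $\mathscr B_{\mathcal F}$ be the $\sigma$-algebra on $\mathbb R$ generated by $\mathscr A$. Assume that $s>s_0$. Then there is a finite measure $\Lambda\colon\mathscr B_{\mathcal F}\to[0,\infty)$ such that for every $J\in\mathscr B_{\mathcal F}$ the sets $f_{a_1}(J),\dots,f_{a_n}(J)$ belong to $\mathscr B_{\mathcal F}$ and $$\Lambda(J)=\tfrac1s\left[\Lambda(f_{a_1}(J))+\cdots+\Lambda(f_{a_n}(J))\right],$$ and such that for every $J\in\mathscr A$ the limit $$\Lambda_0(J)=\lim_{t\to1/s}\frac{L(J)(t)}{L(t)}$$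 (taken over complex $t$ in the disk $|t|<1/s$) exists and $\Lambda(J)=\Lambda_0(J)$. -/

import Mathlib

open Filter Topology Set MeasureTheory

noncomputable section

/-- A (non-degenerate) system of `n` continuous strictly monotone functions
`f i : [left i, right i] → ℝ`. Only the values of `f i` on `[left i, right i]` are ever used. -/
structure MonotoneSystem (n : ℕ) where
  left : Fin n → ℝ
  right : Fin n → ℝ
  left_lt_right : ∀ i, left i < right i
  f : Fin n → ℝ → ℝ
  continuousOn : ∀ i, ContinuousOn (f i) (Icc (left i) (right i))
  strictMono_or_strictAnti : ∀ i,
    StrictMonoOn (f i) (Icc (left i) (right i)) ∨ StrictAntiOn (f i) (Icc (left i) (right i))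

namespace MonotoneSystem

variable {n : ℕ} (F : MonotoneSystem n)

/-- The domain `I i` of the `i`-th function. -/
def I (i : Fin n) : Set ℝ := Icc (F.left i) (F.right i)

/-- The set `f i (J)`, meaning the image of `J ∩ I i`. -/
def image (i : Fin n) (J : Set ℝ) : Set ℝ := F.f i '' (J ∩ F.I i)

/-- The turning points: the endpoints of the domains. -/
def turningPoints : Set ℝ := range F.left ∪ range F.right

/-- The domain of `f_g` for a positive word `g = a_{i₁} a_{i₂} ⋯ a_{iₘ}`, where
`f_g = f_{iₘ} ∘ ⋯ ∘ f_{i₂} ∘ f_{i₁}`; the empty word gives the identity of `ℝ`. -/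
def dom : List (Fin n) → Set ℝ
  | [] => univ
  | i :: g => {x | x ∈ F.I i ∧ F.f i x ∈ dom g}

/-- Positive words `g` such that the domain of `f_g` has non-empty interior. -/
def fatWords : Set (List (Fin n)) := {g | (interior (F.dom g)).Nonempty}

/-- Words in `fatWords` that are admissible for `x`. -/
def fatWordsAt (x : ℝ) : Set (List (Fin n)) := {g | g ∈ F.fatWords ∧ x ∈ F.dom g}

/-- `ℓ(m | J)`. -/
def lap (J : Set ℝ) (m : ℕ) : ℕ :=
  {g | g ∈ F.fatWords ∧ g.length = m ∧ (interior (F.dom g ∩ J)).Nonempty}.ncard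

/-- `ℓ_x(m)`. -/
def lapAt (x : ℝ) (m : ℕ) : ℕ :=
  {g | g ∈ F.fatWordsAt x ∧ g.length = m ∧ x ∈ interior (F.dom g)}.ncard

/-- `ℓ'_c(m)`. -/
def lapBdry (c : ℝ) (m : ℕ) : ℕ :=
  {g | g ∈ F.fatWordsAt c ∧ g.length = m ∧ c ∈ frontier (F.dom g)}.ncard

/-- The growth number `s = limsup ℓ(m)^{1/m}`. -/
def s : ℝ := limsup (fun m : ℕ => (F.lap univ m : ℝ) ^ (1 / (m : ℝ))) atTop

/-- `s₀ = max_c limsup ℓ'_c(m)^{1/m}`, over the (finitely many) turning points `c`. -/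
def s₀ : ℝ :=
  ⨆ c : F.turningPoints, limsup (fun m : ℕ => (F.lapBdry c m : ℝ) ^ (1 / (m : ℝ))) atTop

/-- The power series `L(J)(t) = ∑_{m ≥ 1} ℓ(m | J) t^{m-1}`. -/
def L (J : Set ℝ) (t : ℂ) : ℂ := ∑' m : ℕ, (F.lap J (m + 1) : ℂ) * t ^ m

/-- The points `x` with `limsup (1/m) log ℓ_x(m) < log s`, in the extended reals
(`log 0 = -∞`). -/
def slowPoints : Set ℝ :=
  {x | limsup (fun m : ℕ => ENNReal.log (F.lapAt x m) / (m : EReal)) atTop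
    < ENNReal.log (ENNReal.ofReal F.s)}

/-- The half-lines and bounded intervals with endpoints in `slowPoints`. -/
def slowIntervals : Set (Set ℝ) :=
  {J | ∃ x ∈ F.slowPoints, ∃ y ∈ F.slowPoints,
    J = Iio x ∨ J = Iic x ∨ J = Ioo x y ∨ J = Ico x y ∨ J = Ioc x y ∨ J = Icc x y ∨
      J = Ici x ∨ J = Ioi x}

/-- The algebra of finite unions of `slowIntervals`. -/
def slowAlgebra : Set (Set ℝ) :=
  {U | ∃ T : Set (Set ℝ), T.Finite ∧ T ⊆ F.slowIntervals ∧ U = ⋃₀ T}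

/-- The σ-algebra generated by `slowAlgebra`. -/
@[reducible] def slowSigma : MeasurableSpace ℝ := MeasurableSpace.generateFrom F.slowAlgebra

end MonotoneSystem

end

/-!
The power series `L J` satisfies an exact renewal equation: words of length `m + 1` seen by `J` are
words of length `m` seen by the images of `J` (`lap_succ`). For a half-line `Iio x` the images are
intervals, that is, differences of half-lines up to words whose domain is cut at an endpoint. So
`lap (Iio x)` satisfies an inhomogeneous linear recursion governed by a signed transfer operator,
in which the values at finitely many points, the images of the turning points, enter as unknowns.
All coefficients and errors are bounded by the numbers `lapAt`; these grow at a rate less than `s`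
at slow points, and the images of turning points are slow because `s₀ < s`. Solving the resulting
finite linear system of generating functions (a kneading matrix) by Cramer's rule,
`exists_denominator` gives an analytic `d` near the closed disk of radius `1 / s`, with `d 0 = 1`,
such that every `d * L (Iio x)` with `x` slow is analytic there.

Hence `L (Iio x) / L univ` is meromorphic at `1 / s`. It takes values in `[0, 1]` on the real axis
and so has a limit. As `lap univ` is submultiplicative, `lap univ m ≥ s ^ m`, so `L univ` has a pole
at `1 / s` and slowly growing errors do not affect the limits (`HasDensity`). These are therefore
additive on intervals with slow endpoints and satisfy the scaling relation
(`hasDensity_of_image`).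

For countable additivity, take the upper density of `Iio x` as a distribution function defined for
all real `x`. Submultiplicativity bounds the upper density of `J` by `lap J m / s ^ m` for every
`m`, and near a slow point `y` only the words of `fatWordsAt y` contribute to `lap J m`; their
number is `o(s ^ m)` (`slowGrowth_fatCount`). So the distribution function is continuous at slow
points (`continuousAt_dist`), and its Stieltjes measure gives all sets in the algebra their density.
The scaling relation passes to the σ-algebra by Dynkin's lemma.
-/

noncomputable section

open Finset.HasAntidiagonal (antidiagonal)

/-! ### Words, domains and lap numbers -/

namespace MonotoneSystem

theorem ncard_eq_sum_words {n : ℕ} (m : ℕ) (P : List (Fin n) → Prop) [DecidablePred P]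
    (S : Set (List (Fin n))) (hS : ∀ g, g ∈ S ↔ g.length = m ∧ P g) :
    S.ncard = ∑ g ∈ (List.finite_length_eq (Fin n) m).toFinset, if P g then 1 else 0 := by
  rw [← Finset.card_filter, ← Set.ncard_coe_finset]
  congr 1
  ext g
  simp [hS]

/-- The words of length `m` in `n` letters. -/
def words (n m : ℕ) : Finset (List (Fin n)) := (List.finite_length_eq (Fin n) m).toFinset

@[simp]
theorem mem_words {n m : ℕ} {g : List (Fin n)} : g ∈ words n m ↔ g.length = m := by
  simp [words]

theorem words_zero (n : ℕ) : words n 0 = {[]} := by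
  ext g; simp

theorem sum_words_succ {n : ℕ} (m : ℕ) (φ : List (Fin n) → ℕ) :
    ∑ g ∈ words n (m + 1), φ g = ∑ i, ∑ g ∈ words n m, φ (i :: g) := by
  rw [← Finset.sum_product']
  symm
  refine Finset.sum_bij (fun p _ => p.1 :: p.2) ?_ ?_ ?_ ?_
  · rintro ⟨i, g⟩ h
    simpa using h
  · rintro ⟨i, g⟩ _ ⟨j, h⟩ _ e
    simpa using e
  · rintro g hg
    cases g with
    | nil => simp at hg
    | cons i g => exact ⟨(i, g), by simpa using hg, rfl⟩
  · intros; rfl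

theorem card_words (n m : ℕ) : (words n m).card = n ^ m := by
  induction m with
  | zero => simp [words_zero]
  | succ m ih =>
    rw [Finset.card_eq_sum_ones, sum_words_succ]
    simp [ih, pow_succ, mul_comm]

/-- A subset of the line with non-empty interior keeps it when one point is removed. -/
theorem interior_sdiff_singleton_nonempty {A : Set ℝ} (h : (interior A).Nonempty) (p : ℝ) :
    (interior (A \ {p})).Nonempty := by
  have h2 : (interior A ∩ {p}ᶜ).Nonempty :=
    (dense_compl_singleton p).inter_open_nonempty _ isOpen_interior h
  refine h2.mono (interior_maximal (fun x hx => ⟨interior_subset hx.1, hx.2⟩) ?_)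
  exact isOpen_interior.inter isOpen_compl_singleton

theorem exists_Icc_subset {A : Set ℝ} (h : (interior A).Nonempty) :
    ∃ a b, a < b ∧ Icc a b ⊆ A := by
  obtain ⟨x, hx⟩ := h
  obtain ⟨e, he, hb⟩ := Metric.isOpen_iff.1 isOpen_interior x hx
  refine ⟨x - e / 2, x + e / 2, by linarith, fun y hy => interior_subset (hb ?_)⟩
  rw [Real.ball_eq_Ioo]
  exact ⟨by linarith [hy.1], by linarith [hy.2]⟩

theorem interior_nonempty_of_uIcc_subset {A : Set ℝ} {a b : ℝ} (hab : a ≠ b)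
    (h : uIcc a b ⊆ A) : (interior A).Nonempty := by
  refine Nonempty.mono (interior_mono h) ?_
  rw [uIcc, interior_Icc]
  exact nonempty_Ioo.2 (by simpa using hab.symm)

variable {n : ℕ} (F : MonotoneSystem n)

theorem injOn (i : Fin n) : InjOn (F.f i) (F.I i) := by
  rcases F.strictMono_or_strictAnti i with h | h
  exacts [h.injOn, h.injOn]

theorem uIcc_subset_I {i : Fin n} {a b : ℝ} (ha : a ∈ F.I i) (hb : b ∈ F.I i) :
    uIcc a b ⊆ F.I i := by
  have : OrdConnected (F.I i) := ordConnected_Icc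
  exact this.uIcc_subset ha hb

theorem left_mem (i : Fin n) : F.left i ∈ F.I i := left_mem_Icc.2 (F.left_lt_right i).le

theorem right_mem (i : Fin n) : F.right i ∈ F.I i := right_mem_Icc.2 (F.left_lt_right i).le

theorem image_uIcc {i : Fin n} {a b : ℝ} (ha : a ∈ F.I i) (hb : b ∈ F.I i) :
    F.f i '' uIcc a b = uIcc (F.f i a) (F.f i b) := by
  have hsub := F.uIcc_subset_I ha hb
  apply Subset.antisymm
  · rw [image_subset_iff]
    rcases F.strictMono_or_strictAnti i with h | h
    · exact (h.monotoneOn.mono hsub).mapsTo_uIcc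
    · exact (h.antitoneOn.mono hsub).mapsTo_uIcc
  · intro y hy
    exact intermediate_value_uIcc ((F.continuousOn i).mono hsub) hy

theorem interior_image_nonempty_iff {i : Fin n} {A : Set ℝ} (hA : A ⊆ F.I i) :
    (interior (F.f i '' A)).Nonempty ↔ (interior A).Nonempty := by
  constructor
  · intro h
    obtain ⟨u, v, huv, hsub⟩ := exists_Icc_subset h
    obtain ⟨a, ha, rfl⟩ := hsub (left_mem_Icc.2 huv.le)
    obtain ⟨b, hb, rfl⟩ := hsub (right_mem_Icc.2 huv.le)
    refine interior_nonempty_of_uIcc_subset (a := a) (b := b) (fun e => huv.ne (by rw [e])) ?_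
    intro x hx
    have h1 : F.f i x ∈ F.f i '' A := by
      apply hsub
      rw [← uIcc_of_le huv.le, ← F.image_uIcc (hA ha) (hA hb)]
      exact mem_image_of_mem _ hx
    obtain ⟨x', hx', e⟩ := h1
    rwa [← F.injOn i (hA hx') (F.uIcc_subset_I (hA ha) (hA hb) hx) e]
  · intro h
    obtain ⟨a, b, hab, hsub⟩ := exists_Icc_subset h
    have ha := hsub (left_mem_Icc.2 hab.le)
    have hb := hsub (right_mem_Icc.2 hab.le)
    refine interior_nonempty_of_uIcc_subset (a := F.f i a) (b := F.f i b)
      (fun e => hab.ne (F.injOn i (hA ha) (hA hb) e)) ?_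
    rw [← F.image_uIcc (hA ha) (hA hb), uIcc_of_le hab.le]
    exact image_mono hsub

theorem dom_nil : F.dom [] = univ := rfl

theorem dom_cons_subset (i : Fin n) (g : List (Fin n)) : F.dom (i :: g) ⊆ F.I i :=
  fun _ h => h.1

theorem ordConnected_dom (g : List (Fin n)) : OrdConnected (F.dom g) := by
  induction g with
  | nil => exact ordConnected_univ
  | cons i g ih =>
    refine ordConnected_iff_uIcc_subset.2 fun x hx y hy z hz => ?_
    refine ⟨F.uIcc_subset_I hx.1 hy.1 hz, ih.uIcc_subset hx.2 hy.2 ?_⟩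
    rw [← F.image_uIcc hx.1 hy.1]
    exact mem_image_of_mem _ hz

theorem isClosed_dom (g : List (Fin n)) : IsClosed (F.dom g) := by
  induction g with
  | nil => exact isClosed_univ
  | cons i g ih =>
    exact (F.continuousOn i).preimage_isClosed_of_isClosed isClosed_Icc ih

theorem image_dom_cons_inter (i : Fin n) (g : List (Fin n)) (J : Set ℝ) :
    F.f i '' (F.dom (i :: g) ∩ J) = F.dom g ∩ F.image i J := by
  ext y
  constructor
  · rintro ⟨x, ⟨⟨h1, h2⟩, h3⟩, rfl⟩
    exact ⟨h2, x, ⟨h3, h1⟩, rfl⟩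
  · rintro ⟨h2, x, ⟨h3, h1⟩, rfl⟩
    exact ⟨x, ⟨⟨h1, h2⟩, h3⟩, rfl⟩

theorem fat_cons_inter_iff (i : Fin n) (g : List (Fin n)) (J : Set ℝ) :
    (interior (F.dom (i :: g) ∩ J)).Nonempty ↔ (interior (F.dom g ∩ F.image i J)).Nonempty := by
  rw [← image_dom_cons_inter, F.interior_image_nonempty_iff]
  exact inter_subset_left.trans (F.dom_cons_subset i g)

theorem fatWords_of_cons {i : Fin n} {g : List (Fin n)} (h : i :: g ∈ F.fatWords) :
    g ∈ F.fatWords := by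
  have h1 := (F.fat_cons_inter_iff i g univ).1 (by rwa [inter_univ])
  exact h1.mono (interior_mono inter_subset_left)

open scoped Classical in
theorem lap_eq_sum (J : Set ℝ) (m : ℕ) :
    F.lap J m = ∑ g ∈ words n m, if (interior (F.dom g ∩ J)).Nonempty then 1 else 0 := by
  refine ncard_eq_sum_words m (fun g => (interior (F.dom g ∩ J)).Nonempty) _ fun g => ?_
  exact ⟨fun h => ⟨h.2.1, h.2.2⟩,
    fun h => ⟨h.2.mono (interior_mono inter_subset_left), h.1, h.2⟩⟩

open scoped Classical in
theorem lapAt_eq_sum (x : ℝ) (m : ℕ) :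
    F.lapAt x m = ∑ g ∈ words n m, if x ∈ interior (F.dom g) then 1 else 0 :=
  ncard_eq_sum_words m _ _ fun _ => ⟨fun h => ⟨h.2.1, h.2.2⟩,
    fun h => ⟨⟨⟨x, h.2⟩, interior_subset h.2⟩, h.1, h.2⟩⟩

open scoped Classical in
theorem lapBdry_eq_sum (c : ℝ) (m : ℕ) :
    F.lapBdry c m = ∑ g ∈ words n m,
      if g ∈ F.fatWordsAt c ∧ c ∈ frontier (F.dom g) then 1 else 0 :=
  ncard_eq_sum_words m _ _ fun _ => and_left_comm

/-- The number of words of length `m` in `fatWordsAt x`. -/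
def fatCount (x : ℝ) (m : ℕ) : ℕ := {g | g ∈ F.fatWordsAt x ∧ g.length = m}.ncard

open scoped Classical in
theorem fatCount_eq_sum (x : ℝ) (m : ℕ) :
    F.fatCount x m = ∑ g ∈ words n m, if g ∈ F.fatWordsAt x then 1 else 0 :=
  ncard_eq_sum_words m _ _ fun _ => and_comm

/-- The exact renewal equation, obtained by removing the first letter of a word: `f i` preserves
having non-empty interior for subsets of its domain. -/
theorem lap_succ (J : Set ℝ) (m : ℕ) : F.lap J (m + 1) = ∑ i, F.lap (F.image i J) m := by
  classical
  simp only [lap_eq_sum, sum_words_succ]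
  exact Finset.sum_congr rfl fun i _ => Finset.sum_congr rfl fun g _ =>
    if_congr (F.fat_cons_inter_iff i g J) rfl rfl

theorem lap_mono {J K : Set ℝ} (h : J ⊆ K) (m : ℕ) : F.lap J m ≤ F.lap K m := by
  classical
  simp only [lap_eq_sum]
  refine Finset.sum_le_sum fun g _ => ?_
  have : (interior (F.dom g ∩ J)).Nonempty → (interior (F.dom g ∩ K)).Nonempty :=
    fun h' => h'.mono (interior_mono (inter_subset_inter_right _ h))
  split_ifs <;> simp_all

theorem lap_sdiff_singleton (J : Set ℝ) (p : ℝ) (m : ℕ) : F.lap (J \ {p}) m = F.lap J m := by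
  classical
  refine (F.lap_mono sdiff_subset m).antisymm ?_
  simp only [lap_eq_sum]
  refine Finset.sum_le_sum fun g _ => ?_
  have : (interior (F.dom g ∩ J)).Nonempty → (interior (F.dom g ∩ (J \ {p}))).Nonempty := by
    intro h'
    rw [← inter_sdiff_assoc]
    exact interior_sdiff_singleton_nonempty h' p
  split_ifs <;> simp_all

theorem lap_empty (m : ℕ) : F.lap ∅ m = 0 := by
  simp [lap_eq_sum]

/-- Cutting `J` at `x` loses no words. -/
theorem lap_le_add (J : Set ℝ) (x : ℝ) (m : ℕ) :
    F.lap J m ≤ F.lap (J ∩ Iio x) m + F.lap (J ∩ Ioi x) m := by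
  classical
  simp only [lap_eq_sum, ← Finset.sum_add_distrib]
  refine Finset.sum_le_sum fun g _ => ?_
  have : (interior (F.dom g ∩ J)).Nonempty → (interior (F.dom g ∩ (J ∩ Iio x))).Nonempty ∨
      (interior (F.dom g ∩ (J ∩ Ioi x))).Nonempty := by
    intro h'
    obtain ⟨a, b, hab, hsub⟩ := exists_Icc_subset h'
    rcases lt_or_ge a x with h | h
    · refine Or.inl (interior_nonempty_of_uIcc_subset (a := a) (b := (a + min b x) / 2) ?_ ?_)
      · have := lt_min hab h
        linarith
      · have := lt_min hab h
        rw [uIcc_of_le (by linarith)]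
        intro y hy
        have h1 : y ∈ Icc a b := ⟨hy.1, by linarith [hy.2, min_le_left b x]⟩
        exact ⟨(hsub h1).1, (hsub h1).2, show y < x by linarith [hy.2, min_le_right b x]⟩
    · refine Or.inr (interior_nonempty_of_uIcc_subset (a := (a + b) / 2) (b := b) ?_ ?_)
      · linarith
      · rw [uIcc_of_le (by linarith)]
        intro y hy
        have h1 : y ∈ Icc a b := ⟨by linarith [hy.1], hy.2⟩
        exact ⟨(hsub h1).1, (hsub h1).2, show x < y by linarith [hy.1]⟩
  split_ifs <;> simp_all

/-- Cutting `J` at `x` counts twice only words whose domain is cut, since domains are convex. -/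
theorem lap_add_le (J : Set ℝ) (x : ℝ) (m : ℕ) :
    F.lap (J ∩ Iio x) m + F.lap (J ∩ Ioi x) m ≤ F.lap J m + F.lapAt x m := by
  classical
  simp only [lap_eq_sum, lapAt_eq_sum, ← Finset.sum_add_distrib]
  refine Finset.sum_le_sum fun g _ => ?_
  have h1 : (interior (F.dom g ∩ (J ∩ Iio x))).Nonempty → (interior (F.dom g ∩ J)).Nonempty :=
    fun h' => h'.mono (interior_mono (inter_subset_inter_right _ inter_subset_left))
  have h2 : (interior (F.dom g ∩ (J ∩ Ioi x))).Nonempty → (interior (F.dom g ∩ J)).Nonempty :=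
    fun h' => h'.mono (interior_mono (inter_subset_inter_right _ inter_subset_left))
  have h3 : (interior (F.dom g ∩ (J ∩ Iio x))).Nonempty →
      (interior (F.dom g ∩ (J ∩ Ioi x))).Nonempty → x ∈ interior (F.dom g) := by
    rintro ⟨a, ha⟩ ⟨b, hb⟩
    have ha := interior_subset ha
    have hb := interior_subset hb
    rw [mem_interior_iff_mem_nhds]
    exact mem_of_superset (Icc_mem_nhds ha.2.2 hb.2.2) ((F.ordConnected_dom g).out ha.1 hb.1)
  split_ifs <;> simp_all

theorem lap_zero_le (J : Set ℝ) : F.lap J 0 ≤ 1 := by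
  classical
  rw [lap_eq_sum, words_zero, Finset.sum_singleton]
  split_ifs <;> simp

/-- Submultiplicativity of lap numbers. -/
theorem lap_add_le_mul (J : Set ℝ) (m k : ℕ) :
    F.lap J (m + k) ≤ F.lap J m * F.lap univ k := by
  induction m generalizing J with
  | zero =>
    classical
    rw [zero_add, F.lap_eq_sum J 0, words_zero, Finset.sum_singleton]
    split_ifs with h
    · rw [one_mul]; exact F.lap_mono (subset_univ _) k
    · rw [zero_mul, Nat.le_zero, lap_eq_sum]
      refine Finset.sum_eq_zero fun g _ => if_neg fun h' => h (h'.mono (interior_mono ?_))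
      exact fun x hx => ⟨mem_univ _, hx.2⟩
  | succ m ih =>
    rw [show m + 1 + k = m + k + 1 by ring, lap_succ, lap_succ, Finset.sum_mul]
    exact Finset.sum_le_sum fun i _ => ih _

theorem lap_le_pow (J : Set ℝ) (m : ℕ) : F.lap J m ≤ n ^ m := by
  classical
  rw [lap_eq_sum, ← card_words, Finset.card_eq_sum_ones]
  refine Finset.sum_le_sum fun g _ => ?_
  split_ifs <;> simp

theorem lapAt_zero (x : ℝ) : F.lapAt x 0 = 1 := by
  classical
  rw [lapAt_eq_sum, words_zero, Finset.sum_singleton, dom_nil]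
  simp

theorem lapBdry_le_pow (c : ℝ) (m : ℕ) : F.lapBdry c m ≤ n ^ m := by
  classical
  rw [lapBdry_eq_sum, ← card_words, Finset.card_eq_sum_ones]
  refine Finset.sum_le_sum fun g _ => ?_
  split_ifs <;> simp

theorem image_mem_nhds {i : Fin n} {x : ℝ} {S : Set ℝ} (hx : x ∈ Ioo (F.left i) (F.right i))
    (hS : S ∈ 𝓝 x) : F.f i '' S ∈ 𝓝 (F.f i x) := by
  obtain ⟨a, b, hab, hab', hsub⟩ :=
    exists_Icc_mem_subset_of_mem_nhds (inter_mem hS (Ioo_mem_nhds hx.1 hx.2))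
  have hlt : a < x ∧ x < b := by
    have := mem_interior_iff_mem_nhds.2 hab'
    rwa [interior_Icc] at this
  have ha : a ∈ F.I i := Ioo_subset_Icc_self (hsub ⟨le_rfl, hab.1.trans hab.2⟩).2
  have hb : b ∈ F.I i := Ioo_subset_Icc_self (hsub ⟨hab.1.trans hab.2, le_rfl⟩).2
  have hxI : x ∈ F.I i := Ioo_subset_Icc_self hx
  have him := F.image_uIcc ha hb
  rw [uIcc_of_le (hab.1.trans hab.2)] at him
  refine mem_of_superset ?_ (image_mono (fun y hy => (hsub hy).1) : F.f i '' Icc a b ⊆ _)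
  rw [him]
  rcases F.strictMono_or_strictAnti i with h | h
  · have h1 := h ha hxI hlt.1
    have h2 := h hxI hb hlt.2
    rw [uIcc_of_le (h1.trans h2).le]
    exact Icc_mem_nhds h1 h2
  · have h1 := h ha hxI hlt.1
    have h2 := h hxI hb hlt.2
    rw [uIcc_of_ge (h2.trans h1).le]
    exact Icc_mem_nhds h2 h1

theorem mem_interior_dom_cons {i : Fin n} {g : List (Fin n)} {x : ℝ} :
    x ∈ interior (F.dom (i :: g)) ↔
      x ∈ Ioo (F.left i) (F.right i) ∧ F.f i x ∈ interior (F.dom g) := by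
  constructor
  · intro h
    have hx : x ∈ Ioo (F.left i) (F.right i) := by
      have := interior_mono (F.dom_cons_subset i g) h
      rwa [I, interior_Icc] at this
    refine ⟨hx, ?_⟩
    rw [mem_interior_iff_mem_nhds] at h ⊢
    refine mem_of_superset (F.image_mem_nhds hx h) ?_
    rintro _ ⟨y, hy, rfl⟩
    exact hy.2
  · rintro ⟨hx, h⟩
    rw [mem_interior_iff_mem_nhds] at h ⊢
    have hI : Icc (F.left i) (F.right i) ∈ 𝓝 x := Icc_mem_nhds hx.1 hx.2
    have hc : ContinuousAt (F.f i) x := (F.continuousOn i).continuousAt hI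
    filter_upwards [hI, hc h] with y h1 h2 using ⟨h1, h2⟩

open scoped Classical in
/-- The analogue of `lap_succ` for words whose domain is a neighbourhood of `x`. -/
theorem lapAt_succ (x : ℝ) (m : ℕ) : F.lapAt x (m + 1) =
    ∑ i, if x ∈ Ioo (F.left i) (F.right i) then F.lapAt (F.f i x) m else 0 := by
  simp only [lapAt_eq_sum, sum_words_succ, mem_interior_dom_cons]
  refine Finset.sum_congr rfl fun i _ => ?_
  split_ifs with h <;> simp [h]

/-- The two endpoints of the domain of the `i`-th function. -/
def endpoint (j : Fin n × Bool) : ℝ := if j.2 then F.right j.1 else F.left j.1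

/-- The images of the endpoints of the domains under the respective functions. -/
def endValue (j : Fin n × Bool) : ℝ := F.f j.1 (F.endpoint j)

theorem endpoint_mem (j : Fin n × Bool) : F.endpoint j ∈ F.I j.1 := by
  unfold endpoint
  split_ifs
  exacts [F.right_mem _, F.left_mem _]

theorem endpoint_mem_turningPoints (j : Fin n × Bool) : F.endpoint j ∈ F.turningPoints := by
  unfold endpoint
  split_ifs
  exacts [Or.inr (mem_range_self _), Or.inl (mem_range_self _)]

theorem endpoint_not_mem_interior (j : Fin n × Bool) (g : List (Fin n)) :
    F.endpoint j ∉ interior (F.dom (j.1 :: g)) := by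
  intro h
  have := interior_mono (F.dom_cons_subset j.1 g) h
  rw [I, interior_Icc] at this
  unfold endpoint at this
  split_ifs at this
  exacts [lt_irrefl _ this.2, lt_irrefl _ this.1]

/-- Near an endpoint `c` of its domain the function `f i` maps a one-sided neighbourhood of `c`
into any neighbourhood of `f i c`; so a word admissible around `f i c` yields one with `c` on the
boundary of its domain. -/
theorem lapAt_endValue_le (j : Fin n × Bool) (m : ℕ) :
    F.lapAt (F.endValue j) m ≤ F.lapBdry (F.endpoint j) (m + 1) := by
  classical
  rw [lapAt_eq_sum, lapBdry_eq_sum, sum_words_succ]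
  refine le_trans ?_ (Finset.single_le_sum (f := fun i => ∑ g ∈ words n m,
    if i :: g ∈ F.fatWordsAt (F.endpoint j) ∧ F.endpoint j ∈ frontier (F.dom (i :: g))
      then 1 else 0) (fun _ _ => Nat.zero_le _) (Finset.mem_univ j.1))
  refine Finset.sum_le_sum fun g _ => ?_
  have key : F.endValue j ∈ interior (F.dom g) → j.1 :: g ∈ F.fatWordsAt (F.endpoint j) ∧
      F.endpoint j ∈ frontier (F.dom (j.1 :: g)) := by
    intro h
    have hmem : F.endpoint j ∈ F.dom (j.1 :: g) := ⟨F.endpoint_mem j, interior_subset h⟩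
    refine ⟨⟨?_, hmem⟩, ?_⟩
    · have hc := F.continuousOn j.1 _ (F.endpoint_mem j)
      rw [mem_interior_iff_mem_nhds] at h
      obtain ⟨U, hU, hcU, hsub⟩ := mem_nhdsWithin.1 (hc h)
      obtain ⟨e, he, hball⟩ := Metric.isOpen_iff.1 hU _ hcU
      have hlr := F.left_lt_right j.1
      rw [Real.ball_eq_Ioo] at hball
      have hV : (interior (Ioo (F.endpoint j - e) (F.endpoint j + e) ∩
          Ioo (F.left j.1) (F.right j.1))).Nonempty := by
        rw [Ioo_inter_Ioo, interior_Ioo, nonempty_Ioo]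
        unfold endpoint
        split_ifs <;> simp [hlr, he] <;> constructor <;> linarith
      refine hV.mono (interior_mono fun y hy => ⟨Ioo_subset_Icc_self hy.2, ?_⟩)
      exact hsub ⟨hball hy.1, Ioo_subset_Icc_self hy.2⟩
    · exact ⟨subset_closure hmem, F.endpoint_not_mem_interior j g⟩
  split_ifs <;> simp_all

/-- Words in `fatWordsAt x` start with a letter whose domain has `x` in its interior, or `x` is an
endpoint of the domain of the first letter. -/
theorem fatCount_succ_le (x : ℝ) (m : ℕ) : F.fatCount x (m + 1) ≤
    (∑ i, open scoped Classical in
      if x ∈ Ioo (F.left i) (F.right i) then F.fatCount (F.f i x) m else 0) +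
    ∑ j, F.lapBdry (F.endpoint j) (m + 1) := by
  classical
  rw [Fintype.sum_prod_type, ← Finset.sum_add_distrib, fatCount_eq_sum, sum_words_succ]
  refine Finset.sum_le_sum fun i _ => ?_
  rw [Fintype.sum_bool]
  split_ifs with hx
  · refine le_add_right ?_
    rw [fatCount_eq_sum]
    refine Finset.sum_le_sum fun g _ => ?_
    have : i :: g ∈ F.fatWordsAt x → g ∈ F.fatWordsAt (F.f i x) :=
      fun h => ⟨F.fatWords_of_cons h.1, h.2.2⟩
    split_ifs <;> simp_all
  · rw [zero_add]
    by_cases hxI : x ∈ F.I i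
    · have hj : ∃ b : Bool, x = F.endpoint (i, b) := by
        by_contra hcon
        push Not at hcon
        have h1 := hcon true
        have h2 := hcon false
        simp only [endpoint, if_true, Bool.false_eq_true, if_false] at h1 h2
        exact hx ⟨lt_of_le_of_ne hxI.1 (Ne.symm h2), lt_of_le_of_ne hxI.2 h1⟩
      obtain ⟨b, hb⟩ := hj
      have h1 : (∑ g ∈ words n m, if i :: g ∈ F.fatWordsAt x then 1 else 0) ≤
          F.lapBdry (F.endpoint (i, b)) (m + 1) := by
        rw [lapBdry_eq_sum, sum_words_succ]
        refine le_trans ?_ (Finset.single_le_sum (f := fun i' => ∑ g ∈ words n m,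
          if i' :: g ∈ F.fatWordsAt (F.endpoint (i, b)) ∧
            F.endpoint (i, b) ∈ frontier (F.dom (i' :: g))
            then 1 else 0) (fun _ _ => Nat.zero_le _) (Finset.mem_univ i))
        refine Finset.sum_le_sum fun g _ => ?_
        have : i :: g ∈ F.fatWordsAt x → i :: g ∈ F.fatWordsAt (F.endpoint (i, b)) ∧
            F.endpoint (i, b) ∈ frontier (F.dom (i :: g)) := by
          rw [hb]
          exact fun h => ⟨h, subset_closure h.2, F.endpoint_not_mem_interior (i, b) g⟩
        split_ifs <;> simp_all
      refine h1.trans ?_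
      cases b
      exacts [Nat.le_add_left _ _, Nat.le_add_right _ _]
    · refine le_trans (le_of_eq ?_) (Nat.zero_le _)
      exact Finset.sum_eq_zero fun g _ => if_neg fun h => hxI h.2.1

theorem fatCount_zero (x : ℝ) : F.fatCount x 0 = 1 := by
  classical
  rw [fatCount_eq_sum, words_zero, Finset.sum_singleton, if_pos]
  exact ⟨by simp [fatWords, dom_nil], mem_univ _⟩

/-- A word in `fatWordsAt x` either has `x` in the interior of its domain, or it reaches an
endpoint of some domain after finitely many steps, the previous steps being interior. -/
theorem fatCount_le (x : ℝ) (m : ℕ) : F.fatCount x m ≤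
    F.lapAt x m + ∑ p ∈ antidiagonal m,
      F.lapAt x p.1 * ∑ j, F.lapBdry (F.endpoint j) p.2 := by
  classical
  induction m generalizing x with
  | zero => rw [fatCount_zero, lapAt_zero]; exact Nat.le_add_right _ _
  | succ m ih =>
    refine (F.fatCount_succ_le x m).trans ?_
    rw [Finset.Nat.antidiagonal_succ, Finset.sum_cons, Finset.sum_map]
    simp only [lapAt_zero, one_mul]
    rw [add_left_comm, add_comm]
    refine Nat.add_le_add_left ?_ _
    simp only [Function.Embedding.prodMap, Function.Embedding.coeFn_mk, Prod.map,
      Function.Embedding.refl_apply, lapAt_succ, Finset.sum_mul, Nat.succ_eq_add_one]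
    rw [Finset.sum_comm, ← Finset.sum_add_distrib]
    refine Finset.sum_le_sum fun i _ => ?_
    split_ifs with h
    · exact ih _
    · simp

/-- Domains are closed, so small intervals around `y` meet only domains containing `y`. -/
theorem exists_lap_Ioo_le (y : ℝ) (m : ℕ) :
    ∃ δ > 0, F.lap (Ioo (y - δ) (y + δ)) m ≤ F.fatCount y m := by
  classical
  have h1 : ∀ g ∈ words n m, ∀ᶠ δ in 𝓝[>] (0 : ℝ), y ∉ F.dom g →
      F.dom g ∩ Ioo (y - δ) (y + δ) = ∅ := by
    intro g _
    by_cases hy : y ∈ F.dom g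
    · exact Eventually.of_forall fun _ h => absurd hy h
    · obtain ⟨e, he, hb⟩ := Metric.isOpen_iff.1 (F.isClosed_dom g).isOpen_compl y hy
      filter_upwards [Ioo_mem_nhdsGT he] with δ hδ _
      rw [eq_empty_iff_forall_notMem]
      rintro z ⟨hz, hz2⟩
      refine hb ?_ hz
      rw [Real.ball_eq_Ioo]
      exact ⟨by linarith [hz2.1, hδ.2], by linarith [hz2.2, hδ.2]⟩
  obtain ⟨δ, hδ, hpos⟩ := (((Finset.eventually_all _).2 h1).and self_mem_nhdsWithin).exists
  refine ⟨δ, hpos, ?_⟩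
  rw [lap_eq_sum, fatCount_eq_sum]
  refine Finset.sum_le_sum fun g hg => ?_
  have : (interior (F.dom g ∩ Ioo (y - δ) (y + δ))).Nonempty → g ∈ F.fatWordsAt y := by
    intro h
    refine ⟨h.mono (interior_mono inter_subset_left), ?_⟩
    by_contra hy
    rw [hδ g hg hy] at h
    simp at h
  split_ifs <;> simp_all

end MonotoneSystem

/-! ### Exponential growth -/

/-- The sequence `u` is `O(θ ^ m)` for some `θ < s`, with explicit constants. -/
def SlowGrowth (s : ℝ) (u : ℕ → ℝ) : Prop :=
  ∃ θ, 0 < θ ∧ θ < s ∧ ∃ C, ∀ m, |u m| ≤ C * θ ^ m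

namespace SlowGrowth

variable {s : ℝ} {u v : ℕ → ℝ}

theorem of_eventually {θ C : ℝ} (h0 : 0 < θ) (hs : θ < s)
    (h : ∀ᶠ m in atTop, |u m| ≤ C * θ ^ m) : SlowGrowth s u := by
  obtain ⟨N, hN⟩ := eventually_atTop.1 h
  refine ⟨θ, h0, hs, |C| + ∑ k ∈ Finset.range N, |u k| / θ ^ k, fun m => ?_⟩
  have hp : ∀ k, 0 < θ ^ k := fun k => pow_pos h0 k
  have hsum : 0 ≤ ∑ k ∈ Finset.range N, |u k| / θ ^ k :=
    Finset.sum_nonneg fun k _ => div_nonneg (abs_nonneg _) (hp k).le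
  rcases le_or_gt N m with hm | hm
  · refine (hN m hm).trans (mul_le_mul_of_nonneg_right ?_ (hp m).le)
    linarith [le_abs_self C]
  · rw [← div_le_iff₀ (hp m)]
    have := Finset.single_le_sum (f := fun k => |u k| / θ ^ k)
      (fun k _ => div_nonneg (abs_nonneg _) (hp k).le) (Finset.mem_range.2 hm)
    linarith [abs_nonneg C]

theorem mono (hv : SlowGrowth s v) (h : ∀ m, |u m| ≤ |v m|) : SlowGrowth s u := by
  obtain ⟨θ, h0, hs, C, hC⟩ := hv
  exact ⟨θ, h0, hs, C, fun m => (h m).trans (hC m)⟩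

/-- Two slowly growing sequences admit common constants. -/
theorem common (hu : SlowGrowth s u) (hv : SlowGrowth s v) : ∃ θ, 0 < θ ∧ θ < s ∧ ∃ C, 0 ≤ C ∧
    ∀ m, |u m| ≤ C * θ ^ m ∧ |v m| ≤ C * θ ^ m := by
  obtain ⟨θ, h0, hs, C, hC⟩ := hu
  obtain ⟨η, h0', hs', D, hD⟩ := hv
  have hC0 : 0 ≤ C := by simpa using (abs_nonneg _).trans (hC 0)
  have hD0 : 0 ≤ D := by simpa using (abs_nonneg _).trans (hD 0)
  refine ⟨max θ η, lt_max_of_lt_left h0, max_lt hs hs', C + D, by positivity, fun m => ⟨?_, ?_⟩⟩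
  · exact (hC m).trans (mul_le_mul (by linarith)
      (pow_le_pow_left₀ h0.le (le_max_left _ _) m) (by positivity) (by positivity))
  · exact (hD m).trans (mul_le_mul (by linarith)
      (pow_le_pow_left₀ h0'.le (le_max_right _ _) m) (by positivity) (by positivity))

theorem add (hu : SlowGrowth s u) (hv : SlowGrowth s v) : SlowGrowth s fun m => u m + v m := by
  obtain ⟨θ, h0, hs, C, -, hC⟩ := hu.common hv
  refine ⟨θ, h0, hs, C + C, fun m => (abs_add_le _ _).trans ?_⟩
  linarith [(hC m).1, (hC m).2]

theorem const_mul (hu : SlowGrowth s u) (c : ℝ) : SlowGrowth s fun m => c * u m := by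
  obtain ⟨θ, h0, hs, C, hC⟩ := hu
  refine ⟨θ, h0, hs, |c| * C, fun m => ?_⟩
  rw [abs_mul, mul_assoc]
  exact mul_le_mul_of_nonneg_left (hC m) (abs_nonneg c)

theorem zero (hs : 0 < s) : SlowGrowth s fun _ => 0 :=
  ⟨s / 2, by linarith, by linarith, 0, by simp⟩

theorem sum (hs : 0 < s) {ι : Type*} (S : Finset ι) {w : ι → ℕ → ℝ}
    (h : ∀ j, SlowGrowth s (w j)) : SlowGrowth s fun m => ∑ j ∈ S, w j m := by
  classical
  induction S using Finset.induction_on with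
  | empty => simpa using zero hs
  | insert j S hj ih => simpa only [Finset.sum_insert hj] using (h j).add ih

theorem shift (hu : SlowGrowth s u) : SlowGrowth s fun m => u (m + 1) := by
  obtain ⟨θ, h0, hs, C, hC⟩ := hu
  exact ⟨θ, h0, hs, C * θ, fun m => (hC (m + 1)).trans (by rw [pow_succ]; linarith)⟩

theorem eventually_le (hu : SlowGrowth s u) :
    ∃ η, 0 < η ∧ η < s ∧ ∀ᶠ m in atTop, |u m| ≤ η ^ m := by
  obtain ⟨θ, h0, hs, C, hC⟩ := hu
  obtain ⟨η, h1, h2⟩ := exists_between hs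
  have hη := h0.trans h1
  refine ⟨η, hη, h2, ?_⟩
  have ht : Tendsto (fun m : ℕ => C * (θ / η) ^ m) atTop (𝓝 (C * 0)) :=
    (tendsto_pow_atTop_nhds_zero_of_lt_one (by positivity) ((div_lt_one hη).2 h1)).const_mul C
  rw [mul_zero] at ht
  filter_upwards [ht.eventually_lt_const one_pos] with m hm
  refine (hC m).trans ?_
  rw [div_pow, mul_div_assoc', div_lt_one (by positivity)] at hm
  exact hm.le

theorem convolution (hu : SlowGrowth s u) (hv : SlowGrowth s v) :
    SlowGrowth s fun m => ∑ p ∈ antidiagonal m, u p.1 * v p.2 := by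
  obtain ⟨θ, h0, hs, C, hC0, hC⟩ := hu.common hv
  obtain ⟨η, h1, h2⟩ := exists_between hs
  have hη := h0.trans h1
  have hb : ∀ m : ℕ, |∑ p ∈ antidiagonal m, u p.1 * v p.2| ≤ (m + 1) * (C * C * θ ^ m) := by
    intro m
    refine (Finset.abs_sum_le_sum_abs _ _).trans ?_
    have : ∀ p ∈ antidiagonal m, |u p.1 * v p.2| ≤ C * C * θ ^ m := by
      intro p hp
      rw [Finset.HasAntidiagonal.mem_antidiagonal] at hp
      rw [abs_mul, ← hp, pow_add]
      calc _ ≤ (C * θ ^ p.1) * (C * θ ^ p.2) :=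
            mul_le_mul (hC _).1 (hC _).2 (abs_nonneg _) (by positivity)
        _ = _ := by ring
    refine (Finset.sum_le_sum this).trans ?_
    simp
  have ht : Tendsto (fun m : ℕ => (m : ℝ) * (θ / η) ^ m + (θ / η) ^ m) atTop (𝓝 (0 + 0)) :=
    (tendsto_self_mul_const_pow_of_lt_one (by positivity) ((div_lt_one hη).2 h1)).add
      (tendsto_pow_atTop_nhds_zero_of_lt_one (by positivity) ((div_lt_one hη).2 h1))
  rw [add_zero] at ht
  refine of_eventually (θ := η) (C := C * C) hη h2 ?_
  filter_upwards [ht.eventually_lt_const one_pos] with m hm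
  refine (hb m).trans ?_
  have h3 : ((m : ℝ) + 1) * θ ^ m ≤ η ^ m := by
    rw [← add_one_mul, div_pow, mul_div_assoc', div_lt_one (by positivity)] at hm
    exact hm.le
  calc _ = C * C * ((m + 1) * θ ^ m) := by ring
    _ ≤ _ := mul_le_mul_of_nonneg_left h3 (by positivity)

theorem tendsto_div (hu : SlowGrowth s u) : Tendsto (fun m => u m / s ^ m) atTop (𝓝 0) := by
  obtain ⟨θ, h0, hs, C, hC⟩ := hu
  have hs0 := h0.trans hs
  have ht : Tendsto (fun m : ℕ => C * (θ / s) ^ m) atTop (𝓝 (C * 0)) :=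
    (tendsto_pow_atTop_nhds_zero_of_lt_one (by positivity) ((div_lt_one hs0).2 hs)).const_mul C
  rw [mul_zero] at ht
  refine squeeze_zero_norm (fun m => ?_) ht
  rw [Real.norm_eq_abs, abs_div, abs_of_pos (pow_pos hs0 m), div_pow, mul_div_assoc']
  exact div_le_div_of_nonneg_right (hC m) (by positivity)

/-- A converse of `of_limsup_lt`; the inequality is strict as `θ` stays below `s`. -/
theorem limsup_lt (hu : SlowGrowth s u) (h0 : ∀ m, 0 ≤ u m) :
    limsup (fun m : ℕ => u m ^ (1 / (m : ℝ))) atTop < s := by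
  obtain ⟨η, hη, hs, h⟩ := hu.eventually_le
  refine lt_of_le_of_lt (limsup_le_of_le ?_ ?_) hs
  · exact isCoboundedUnder_le_of_le atTop (x := 0) fun m => Real.rpow_nonneg (h0 m) _
  · filter_upwards [h, eventually_ge_atTop 1] with m hm h1
    have hm' := Real.rpow_le_rpow (h0 m) ((le_abs_self _).trans hm)
      (by positivity : (0 : ℝ) ≤ 1 / (m : ℝ))
    rwa [one_div, Real.pow_rpow_inv_natCast hη.le (by omega), ← one_div] at hm'

theorem of_limsup_lt (hs : 0 < s) (h0 : ∀ m, 0 ≤ u m) {B : ℝ} (hB : 0 ≤ B)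
    (hle : ∀ m, u m ≤ B ^ m)
    (h : limsup (fun m : ℕ => u m ^ (1 / (m : ℝ))) atTop < s) : SlowGrowth s u := by
  obtain ⟨q, hq1, hq2⟩ := exists_between (max_lt h hs)
  have hq0 : 0 < q := (le_max_right _ _).trans_lt hq1
  have hbdd : IsBoundedUnder (· ≤ ·) atTop fun m : ℕ => u m ^ (1 / (m : ℝ)) := by
    refine isBoundedUnder_of_eventually_le (a := B) ?_
    filter_upwards [eventually_ge_atTop 1] with m h1
    have hm' := Real.rpow_le_rpow (h0 m) (hle m) (by positivity : (0 : ℝ) ≤ 1 / (m : ℝ))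
    rwa [one_div, Real.pow_rpow_inv_natCast hB (by omega), ← one_div] at hm'
  refine of_eventually (C := 1) hq0 hq2 ?_
  filter_upwards [eventually_lt_of_limsup_lt ((le_max_left _ _).trans_lt hq1) hbdd,
    eventually_ge_atTop 1] with m hm h1
  rw [abs_of_nonneg (h0 m), one_mul]
  have := pow_le_pow_left₀ (Real.rpow_nonneg (h0 m) _) hm.le m
  rwa [one_div, Real.rpow_inv_natCast_pow (h0 m) (by omega)] at this

end SlowGrowth

namespace MonotoneSystem

variable {n : ℕ} (F : MonotoneSystem n)

theorem s_pos (hs : F.s₀ < F.s) : 0 < F.s := by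
  refine lt_of_le_of_lt (Real.iSup_nonneg fun c => ?_) hs
  rw [limsup_eq]
  refine Real.sInf_nonneg fun a ha => ?_
  obtain ⟨m, hm⟩ := ha.exists
  exact (Real.rpow_nonneg (Nat.cast_nonneg _) _).trans hm

theorem finite_turningPoints : F.turningPoints.Finite := (finite_range _).union (finite_range _)

theorem slowGrowth_lapBdry (hs : F.s₀ < F.s) {c : ℝ} (hc : c ∈ F.turningPoints) :
    SlowGrowth F.s fun m => F.lapBdry c m := by
  refine SlowGrowth.of_limsup_lt (F.s_pos hs) (fun m => Nat.cast_nonneg _)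
    (B := n) (Nat.cast_nonneg _) (fun m => by exact_mod_cast F.lapBdry_le_pow c m) ?_
  refine lt_of_le_of_lt ?_ hs
  have : Finite F.turningPoints := F.finite_turningPoints
  exact le_ciSup (f := fun c : F.turningPoints =>
    limsup (fun m : ℕ => (F.lapBdry c m : ℝ) ^ (1 / (m : ℝ))) atTop)
    (Set.finite_range _).bddAbove ⟨c, hc⟩

theorem slowGrowth_lap {q : ℝ} (h0 : 0 < q) (hq : F.s < q) (J : Set ℝ) :
    SlowGrowth q fun m => F.lap J m := by
  have : SlowGrowth q fun m => F.lap univ m :=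
    SlowGrowth.of_limsup_lt h0 (fun m => Nat.cast_nonneg _)
      (B := n) (Nat.cast_nonneg _) (fun m => by exact_mod_cast F.lap_le_pow _ m) hq
  refine this.mono fun m => ?_
  rw [Nat.abs_cast, Nat.abs_cast]
  exact_mod_cast F.lap_mono (subset_univ _) m

theorem lap_univ_mul_add_le (m j r : ℕ) :
    F.lap univ (m * j + r) ≤ F.lap univ m ^ j * F.lap univ r := by
  induction j with
  | zero => simp
  | succ j ih =>
    rw [show m * (j + 1) + r = m + (m * j + r) by ring, pow_succ', mul_assoc]
    exact (F.lap_add_le_mul univ m _).trans (Nat.mul_le_mul_left _ ih)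

/-- Since `lap univ` is submultiplicative, its growth rate is a lower bound, not only a limit. -/
theorem s_pow_le_lap (hs : 0 < F.s) (m : ℕ) : F.s ^ m ≤ F.lap univ m := by
  rcases Nat.eq_zero_or_pos m with rfl | hm
  · classical
    rw [lap_eq_sum, words_zero, Finset.sum_singleton]
    simp [dom_nil]
  by_contra! hcon
  have hroot : (F.lap univ m : ℝ) ^ ((m : ℝ)⁻¹) < F.s := by
    have := Real.rpow_lt_rpow (Nat.cast_nonneg _) hcon (by positivity : (0 : ℝ) < (m : ℝ)⁻¹)
    rwa [Real.pow_rpow_inv_natCast hs.le hm.ne'] at this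
  obtain ⟨q, hq1, hq2⟩ := exists_between hroot
  have hq0 : 0 < q := (Real.rpow_nonneg (Nat.cast_nonneg _) _).trans_lt hq1
  have hle : (F.lap univ m : ℝ) ≤ q ^ m := by
    have := pow_le_pow_left₀ (Real.rpow_nonneg (Nat.cast_nonneg _) _) hq1.le m
    rwa [Real.rpow_inv_natCast_pow (Nat.cast_nonneg _) hm.ne'] at this
  have hgrow : SlowGrowth F.s fun k => F.lap univ k := by
    refine ⟨q, hq0, hq2, ∑ r ∈ Finset.range m, F.lap univ r / q ^ r, fun k => ?_⟩
    rw [Nat.abs_cast]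
    have h1 := F.lap_univ_mul_add_le m (k / m) (k % m)
    rw [Nat.div_add_mod] at h1
    have h2 : (F.lap univ (k % m) : ℝ) / q ^ (k % m) ≤
        ∑ r ∈ Finset.range m, F.lap univ r / q ^ r :=
      Finset.single_le_sum (f := fun r => (F.lap univ r : ℝ) / q ^ r)
        (fun r _ => by positivity) (Finset.mem_range.2 (Nat.mod_lt k hm))
    calc (F.lap univ k : ℝ) ≤ (F.lap univ m : ℝ) ^ (k / m) * F.lap univ (k % m) := by
          exact_mod_cast h1
      _ ≤ (q ^ m) ^ (k / m) * F.lap univ (k % m) := by gcongr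
      _ = (F.lap univ (k % m) : ℝ) / q ^ (k % m) * q ^ k := by
          have h3 : q ^ k = (q ^ m) ^ (k / m) * q ^ (k % m) := by
            rw [← pow_mul, ← pow_add, Nat.div_add_mod]
          rw [h3]
          field_simp
      _ ≤ _ := by gcongr
  exact lt_irrefl _ (hgrow.limsup_lt fun k => Nat.cast_nonneg _)

theorem log_natCast_div_le_iff {k m : ℕ} (hm : 0 < m) {θ : ℝ} (h0 : 0 < θ) :
    ENNReal.log (k : ENNReal) / (m : EReal) ≤ ENNReal.log (ENNReal.ofReal θ) ↔
      (k : ℝ) ≤ θ ^ m := by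
  rw [EReal.div_le_iff_le_mul (by exact_mod_cast hm) (EReal.natCast_ne_top m),
    ← ENNReal.log_pow, ENNReal.log_le_log_iff, ← ENNReal.ofReal_pow h0.le,
    ← ENNReal.ofReal_natCast, ENNReal.ofReal_le_ofReal_iff (by positivity)]

/-- Slow points in terms of real bounds, without extended logarithms. -/
theorem mem_slowPoints_iff (hs : 0 < F.s) {x : ℝ} :
    x ∈ F.slowPoints ↔ SlowGrowth F.s fun m => F.lapAt x m := by
  constructor
  · intro h
    obtain ⟨b, hb1, hb2⟩ := exists_between (mem_ofPred_eq ▸ h)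
    obtain ⟨β, rfl⟩ := ENNReal.log_surjective b
    rw [ENNReal.log_lt_log_iff] at hb2
    have hβ : β ≠ ⊤ := hb2.ne_top
    have hβs : β.toReal < F.s := by
      rwa [← ENNReal.toReal_lt_toReal hβ ENNReal.ofReal_ne_top, ENNReal.toReal_ofReal hs.le] at hb2
    have h0 : 0 < max β.toReal (F.s / 2) := lt_max_of_lt_right (by linarith)
    refine SlowGrowth.of_eventually (C := 1) h0 (max_lt hβs (by linarith)) ?_
    filter_upwards [eventually_lt_of_limsup_lt hb1, eventually_ge_atTop 1] with m hm h1
    rw [Nat.abs_cast, one_mul, ← log_natCast_div_le_iff h1 h0]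
    refine hm.le.trans (ENNReal.log_le_log ?_)
    rw [← ENNReal.ofReal_toReal hβ]
    exact ENNReal.ofReal_le_ofReal (by simp)
  · intro h
    obtain ⟨η, hη, hηs, hev⟩ := h.eventually_le
    refine lt_of_le_of_lt (b := ENNReal.log (ENNReal.ofReal η))
      (limsup_le_of_le (by isBoundedDefault) ?_)
      (ENNReal.log_lt_log ((ENNReal.ofReal_lt_ofReal_iff hs).2 hηs))
    filter_upwards [hev, eventually_ge_atTop 1] with m hm h1
    rw [log_natCast_div_le_iff h1 hη]
    exact (le_abs_self _).trans hm

theorem endValue_mem_slowPoints (hs : F.s₀ < F.s) (j : Fin n × Bool) :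
    F.endValue j ∈ F.slowPoints := by
  rw [F.mem_slowPoints_iff (F.s_pos hs)]
  refine (F.slowGrowth_lapBdry hs (F.endpoint_mem_turningPoints j)).shift.mono fun m => ?_
  rw [Nat.abs_cast, Nat.abs_cast]
  exact_mod_cast F.lapAt_endValue_le j m

theorem lapAt_apply_le {i : Fin n} {x : ℝ} (hx : x ∈ Ioo (F.left i) (F.right i)) (m : ℕ) :
    F.lapAt (F.f i x) m ≤ F.lapAt x (m + 1) := by
  classical
  rw [lapAt_succ]
  refine le_trans (by rw [if_pos hx]) (Finset.single_le_sum (f := fun i =>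
    if x ∈ Ioo (F.left i) (F.right i) then F.lapAt (F.f i x) m else 0)
    (fun _ _ => Nat.zero_le _) (Finset.mem_univ i))

theorem apply_mem_slowPoints (hs : F.s₀ < F.s) {i : Fin n} {x : ℝ} (hx : x ∈ F.I i)
    (hslow : x ∈ F.slowPoints) : F.f i x ∈ F.slowPoints := by
  by_cases h1 : x = F.left i
  · subst h1; exact F.endValue_mem_slowPoints hs (i, false)
  by_cases h2 : x = F.right i
  · subst h2; exact F.endValue_mem_slowPoints hs (i, true)
  have hx' : x ∈ Ioo (F.left i) (F.right i) :=
    ⟨lt_of_le_of_ne hx.1 (Ne.symm h1), lt_of_le_of_ne hx.2 h2⟩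
  rw [F.mem_slowPoints_iff (F.s_pos hs)] at hslow ⊢
  refine hslow.shift.mono fun m => ?_
  rw [Nat.abs_cast, Nat.abs_cast]
  exact_mod_cast F.lapAt_apply_le hx' m

theorem mem_slowPoints_of_forall_notMem (hs : 0 < F.s) {x : ℝ} (hx : ∀ i, x ∉ F.I i) :
    x ∈ F.slowPoints := by
  classical
  rw [F.mem_slowPoints_iff hs]
  refine SlowGrowth.of_eventually (θ := F.s / 2) (C := 0) (by linarith) (by linarith) ?_
  filter_upwards [eventually_ge_atTop 1] with m hm
  obtain ⟨m, rfl⟩ := Nat.exists_eq_add_of_le' hm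
  rw [lapAt_succ, Finset.sum_eq_zero fun i _ => if_neg fun h => hx i (Ioo_subset_Icc_self h)]
  simp

/-- Slow points to the left and to the right of all domains. -/
theorem exists_bounds (hs : 0 < F.s) : ∃ a ∈ F.slowPoints, ∃ b ∈ F.slowPoints, a < b ∧
    ∀ i, F.I i ⊆ Ioo a b := by
  obtain ⟨M, hM⟩ := F.finite_turningPoints.bddAbove
  obtain ⟨N, hN⟩ := F.finite_turningPoints.bddBelow
  have hl : ∀ i, N ≤ F.left i := fun i => hN (Or.inl (mem_range_self i))
  have hr : ∀ i, F.right i ≤ M := fun i => hM (Or.inr (mem_range_self i))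
  refine ⟨min N M - 1, F.mem_slowPoints_of_forall_notMem hs fun i hi => ?_,
    max N M + 1, F.mem_slowPoints_of_forall_notMem hs fun i hi => ?_, ?_, fun i x hx => ⟨?_, ?_⟩⟩
  · linarith [hl i, hi.1, min_le_left N M]
  · linarith [hr i, hi.2, le_max_right N M]
  · linarith [min_le_left N M, le_max_left N M]
  · linarith [hl i, hx.1, min_le_left N M]
  · linarith [hr i, hx.2, le_max_right N M]

theorem slowGrowth_fatCount (hs : F.s₀ < F.s) {x : ℝ} (hx : x ∈ F.slowPoints) :
    SlowGrowth F.s fun m => F.fatCount x m := by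
  have hs0 := F.s_pos hs
  rw [F.mem_slowPoints_iff hs0] at hx
  have hB : SlowGrowth F.s fun m => ∑ j, (F.lapBdry (F.endpoint j) m : ℝ) :=
    SlowGrowth.sum hs0 _ fun j => F.slowGrowth_lapBdry hs (F.endpoint_mem_turningPoints j)
  refine (hx.add (hx.convolution hB)).mono fun m => ?_
  rw [Nat.abs_cast, abs_of_nonneg (by positivity)]
  exact_mod_cast F.fatCount_le x m

end MonotoneSystem

/-! ### The kneading matrix and meromorphic continuation -/

namespace SlowGrowth

variable {s : ℝ} {u v : ℕ → ℝ}

theorem of_le {q : ℝ} (hu : SlowGrowth s u) (h : s ≤ q) : SlowGrowth q u := by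
  obtain ⟨θ, h0, hs, C, hC⟩ := hu
  exact ⟨θ, h0, hs.trans_le h, C, hC⟩

theorem linear_mul (hu : SlowGrowth s u) : SlowGrowth s fun m => (m + 1) * u m := by
  obtain ⟨θ, h0, hs, C, hC⟩ := hu
  have hg : SlowGrowth s fun m => θ ^ m :=
    ⟨θ, h0, hs, 1, fun m => by rw [one_mul, abs_of_pos (pow_pos h0 m)]⟩
  refine ((hg.convolution hg).const_mul C).mono fun m => ?_
  have h1 : ∑ p ∈ antidiagonal m, θ ^ p.1 * θ ^ p.2 = (m + 1) * θ ^ m := by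
    rw [Finset.sum_congr rfl (g := fun _ => θ ^ m)]
    · simp
    · intro p hp
      rw [← pow_add, Finset.HasAntidiagonal.mem_antidiagonal.1 hp]
  rw [h1, abs_mul, abs_of_nonneg (by positivity : (0 : ℝ) ≤ (m : ℝ) + 1)]
  calc (m + 1) * |u m| ≤ (m + 1) * (C * θ ^ m) := by gcongr; exact hC m
    _ = C * ((m + 1) * θ ^ m) := by ring
    _ ≤ _ := le_abs_self _

theorem norm_term_le {θ C ρ : ℝ} (hC : ∀ m, |u m| ≤ C * θ ^ m) (h0 : 0 < θ) {t : ℂ}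
    (ht : ‖t‖ ≤ ρ) (m : ℕ) : ‖(u m : ℂ) * t ^ m‖ ≤ C * (θ * ρ) ^ m := by
  have hC0 : 0 ≤ C := by simpa using (abs_nonneg _).trans (hC 0)
  rw [norm_mul, norm_pow, Complex.norm_real, Real.norm_eq_abs, mul_pow, ← mul_assoc]
  exact mul_le_mul (hC m) (pow_le_pow_left₀ (norm_nonneg _) ht m) (by positivity) (by positivity)

theorem summable_norm (hu : SlowGrowth s u) {t : ℂ} (ht : ‖t‖ ≤ 1 / s) :
    Summable fun m => ‖(u m : ℂ) * t ^ m‖ := by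
  obtain ⟨θ, h0, hs, C, hC⟩ := hu
  have hs0 := h0.trans hs
  refine Summable.of_nonneg_of_le (fun _ => norm_nonneg _) (norm_term_le hC h0 ht) ?_
  refine (summable_geometric_of_lt_one (by positivity) ?_).mul_left C
  rw [mul_one_div, div_lt_one hs0]
  exact hs

/-- The generating function of a slowly growing sequence is analytic on a neighbourhood of the
closed disk of radius `1 / s`. -/
theorem analyticOnNhd (hu : SlowGrowth s u) :
    AnalyticOnNhd ℂ (fun t : ℂ => ∑' m, (u m : ℂ) * t ^ m) (Metric.closedBall 0 (1 / s)) := by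
  obtain ⟨θ, h0, hs, C, hC⟩ := hu
  obtain ⟨η, h1, h2⟩ := exists_between hs
  have hη := h0.trans h1
  have hd : DifferentiableOn ℂ (fun t : ℂ => ∑' m, (u m : ℂ) * t ^ m) (Metric.ball 0 (1 / η)) := by
    refine Complex.differentiableOn_tsum_of_summable_norm
      (u := fun m => C * (θ * (1 / η)) ^ m) ?_ ?_ Metric.isOpen_ball ?_
    · refine (summable_geometric_of_lt_one (by positivity) ?_).mul_left C
      rw [mul_one_div, div_lt_one hη]
      exact h1
    · intro m
      fun_prop
    · intro m t ht
      exact norm_term_le hC h0 (by simpa using (mem_ball_zero_iff.1 ht).le) m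
  refine (hd.analyticOnNhd Metric.isOpen_ball).mono (Metric.closedBall_subset_ball ?_)
  exact one_div_lt_one_div_of_lt hη h2

end SlowGrowth

theorem AnalyticOnNhd.matrix_det {ι : Type*} [Fintype ι] [DecidableEq ι] {U : Set ℂ}
    {M : ℂ → Matrix ι ι ℂ} (h : ∀ i j, AnalyticOnNhd ℂ (fun t => M t i j) U) :
    AnalyticOnNhd ℂ (fun t => (M t).det) U := by
  simp only [Matrix.det_apply']
  exact Finset.analyticOnNhd_fun_sum _ fun σ _ => analyticOnNhd_const.mul
    (Finset.analyticOnNhd_fun_prod _ fun i _ => h _ _)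

theorem AnalyticOnNhd.matrix_adjugate {ι : Type*} [Fintype ι] [DecidableEq ι] {U : Set ℂ}
    {M : ℂ → Matrix ι ι ℂ} (h : ∀ i j, AnalyticOnNhd ℂ (fun t => M t i j) U) (i j : ι) :
    AnalyticOnNhd ℂ (fun t => (M t).adjugate i j) U := by
  simp only [Matrix.adjugate_apply]
  refine AnalyticOnNhd.matrix_det fun k l => ?_
  by_cases hk : k = j
  · subst hk
    simpa only [Matrix.updateRow_self] using analyticOnNhd_const
  · simpa only [Matrix.updateRow_ne hk] using h k l

/-- Variation of constants for an inhomogeneous linear recursion. -/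
theorem linear_recursion_eq {E : Type*} [AddCommGroup E] [Module ℝ E] (T : E →ₗ[ℝ] E)
    (u r : ℕ → E) (h : ∀ m, u (m + 1) = T (u m) + r m) (m : ℕ) :
    u (m + 1) = (T ^ (m + 1)) (u 0) + ∑ p ∈ antidiagonal m, (T ^ p.1) (r p.2) := by
  induction m with
  | zero => simp [h]
  | succ m ih =>
    rw [h, ih, map_add, map_sum, Finset.Nat.antidiagonal_succ, Finset.sum_cons, Finset.sum_map]
    simp only [pow_succ' T, Module.End.mul_apply, Function.Embedding.prodMap,
      Function.Embedding.coeFn_mk, Prod.map, Function.Embedding.refl_apply, Nat.succ_eq_add_one,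
      pow_zero, Module.End.one_apply]
    abel

theorem exists_gt_norm_le_one_div {s : ℝ} (hs : 0 < s) {t : ℂ}
    (ht : t ∈ Metric.ball (0 : ℂ) (1 / s)) :
    ∃ q, s < q ∧ ‖t‖ ≤ 1 / q := by
  obtain ⟨ρ, h1, h2⟩ := exists_between (mem_ball_zero_iff.1 ht)
  have hρ : 0 < ρ := (norm_nonneg t).trans_lt h1
  refine ⟨1 / ρ, ?_, by simpa using h1.le⟩
  rwa [lt_one_div hs hρ]

namespace MonotoneSystem

variable {n : ℕ} (F : MonotoneSystem n)

/-- The orientation `±1` of the `i`-th function. -/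
def orientation (i : Fin n) : ℝ :=
  open scoped Classical in if StrictMonoOn (F.f i) (F.I i) then 1 else -1

theorem abs_orientation (i : Fin n) : |F.orientation i| = 1 := by
  unfold orientation
  split_ifs <;> simp

/-- The signed transfer operator; only the functions having `x` in the interior of their domain
contribute to its value at `x`. -/
def transfer : (ℝ → ℝ) →ₗ[ℝ] (ℝ → ℝ) where
  toFun φ x := ∑ i, open scoped Classical in
    if x ∈ Ioo (F.left i) (F.right i) then F.orientation i * φ (F.f i x) else 0
  map_add' φ ψ := by
    ext x
    simp only [Pi.add_apply, ← Finset.sum_add_distrib]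
    exact Finset.sum_congr rfl fun i _ => by split_ifs <;> ring
  map_smul' c φ := by
    ext x
    simp only [Pi.smul_apply, smul_eq_mul, RingHom.id_apply, Finset.mul_sum]
    exact Finset.sum_congr rfl fun i _ => by split_ifs <;> ring

open scoped Classical in
theorem transfer_apply (φ : ℝ → ℝ) (x : ℝ) : F.transfer φ x =
    ∑ i, if x ∈ Ioo (F.left i) (F.right i) then F.orientation i * φ (F.f i x) else 0 := rfl

/-- Iterates of the transfer operator at `x` only run through words counted by `lapAt x`. -/
theorem abs_transfer_pow_le {φ : ℝ → ℝ} {A C : ℝ} {k : ℕ}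
    (h : ∀ y, |φ y| ≤ A * F.lapAt y k + C) (p : ℕ) (x : ℝ) :
    |(F.transfer ^ p) φ x| ≤ A * F.lapAt x (p + k) + C * F.lapAt x p := by
  classical
  induction p generalizing x with
  | zero => simpa [lapAt_zero] using h x
  | succ p ih =>
    rw [pow_succ', Module.End.mul_apply, transfer_apply, show p + 1 + k = p + k + 1 by ring,
      lapAt_succ, lapAt_succ]
    push_cast
    rw [Finset.mul_sum, Finset.mul_sum, ← Finset.sum_add_distrib]
    refine (Finset.abs_sum_le_sum_abs _ _).trans (Finset.sum_le_sum fun i _ => ?_)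
    split_ifs with hx
    · rw [abs_mul, abs_orientation, one_mul]
      exact ih _
    · simp

theorem lap_Icc_eq_lap_Ioo (a b : ℝ) (m : ℕ) : F.lap (Icc a b) m = F.lap (Ioo a b) m := by
  rw [← F.lap_sdiff_singleton _ a, ← F.lap_sdiff_singleton _ b]
  congr 1
  ext x
  simp only [Set.mem_sdiff, mem_Icc, mem_singleton_iff, mem_Ioo]
  constructor
  · rintro ⟨⟨⟨h1, h2⟩, h3⟩, h4⟩
    exact ⟨lt_of_le_of_ne h1 (Ne.symm h3), lt_of_le_of_ne h2 h4⟩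
  · rintro ⟨h1, h2⟩
    exact ⟨⟨⟨h1.le, h2.le⟩, h1.ne'⟩, h2.ne⟩

theorem abs_lap_Ioo_sub_le {a b : ℝ} (hab : a < b) (m : ℕ) :
    |(F.lap (Ioo a b) m : ℝ) - (F.lap (Iio b) m - F.lap (Iio a) m)| ≤ F.lapAt a m := by
  have h1 := F.lap_le_add (Iio b) a m
  have h2 := F.lap_add_le (Iio b) a m
  rw [Iio_inter_Iio, min_eq_right hab.le, inter_comm, Ioi_inter_Iio] at h1 h2
  have h1' : (F.lap (Iio b) m : ℝ) ≤ F.lap (Iio a) m + F.lap (Ioo a b) m := by exact_mod_cast h1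
  have h2' : (F.lap (Iio a) m : ℝ) + F.lap (Ioo a b) m ≤ F.lap (Iio b) m + F.lapAt a m := by
    exact_mod_cast h2
  rw [abs_le]
  constructor <;> linarith

theorem abs_lap_uIcc_sub_le {i : Fin n} {a b : ℝ} (ha : a ∈ F.I i) (hb : b ∈ F.I i) (hab : a < b)
    (m : ℕ) : |(F.lap (uIcc (F.f i a) (F.f i b)) m : ℝ) -
      F.orientation i * (F.lap (Iio (F.f i b)) m - F.lap (Iio (F.f i a)) m)| ≤
        F.lapAt (F.f i a) m + F.lapAt (F.f i b) m := by
  unfold orientation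
  split_ifs with h
  · have h1 := h ha hb hab
    rw [uIcc_of_le h1.le, lap_Icc_eq_lap_Ioo, one_mul]
    exact (F.abs_lap_Ioo_sub_le h1 m).trans (by simp)
  · have h1 := ((F.strictMono_or_strictAnti i).resolve_left h) ha hb hab
    rw [uIcc_of_ge h1.le, lap_Icc_eq_lap_Ioo, neg_one_mul, neg_sub]
    exact (F.abs_lap_Ioo_sub_le h1 m).trans (by simp)

theorem image_Iic {i : Fin n} {x : ℝ} (hx : x ∈ F.I i) :
    F.image i (Iic x) = uIcc (F.f i (F.left i)) (F.f i x) := by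
  rw [← F.image_uIcc (F.left_mem i) hx, image, uIcc_of_le hx.1]
  congr 1
  ext y
  exact ⟨fun h => ⟨h.2.1, h.1⟩, fun h => ⟨h.2, h.1, h.2.trans hx.2⟩⟩

theorem image_Iio {i : Fin n} {x : ℝ} (hx : x ∈ F.I i) :
    F.image i (Iio x) = uIcc (F.f i (F.left i)) (F.f i x) \ {F.f i x} := by
  rw [← image_Iic F hx]
  ext y
  constructor
  · rintro ⟨z, ⟨h1, h2⟩, rfl⟩
    exact ⟨⟨z, ⟨mem_Iic.2 (mem_Iio.1 h1).le, h2⟩, rfl⟩, fun h => h1.ne (F.injOn i h2 hx h)⟩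
  · rintro ⟨⟨z, ⟨h1, h2⟩, rfl⟩, h⟩
    exact ⟨z, ⟨lt_of_le_of_ne (mem_Iic.1 h1) fun e => h (congrArg (F.f i) e), h2⟩, rfl⟩

theorem image_of_subset {i : Fin n} {J : Set ℝ} (h : F.I i ⊆ J) :
    F.image i J = uIcc (F.f i (F.left i)) (F.f i (F.right i)) := by
  rw [← F.image_uIcc (F.left_mem i) (F.right_mem i), image, inter_eq_self_of_subset_right h,
    uIcc_of_le (F.left_lt_right i).le, I]

theorem image_of_disjoint {i : Fin n} {J : Set ℝ} (h : Disjoint J (F.I i)) :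
    F.image i J = ∅ := by
  rw [image, h.inter_eq, image_empty]

/-- The coefficient with which the value at `endValue j` enters the recursion for
`lap (Iio x)`. -/
def endCoeff (j : Fin n × Bool) (x : ℝ) : ℝ :=
  open scoped Classical in
  if j.2 then (if F.right j.1 ≤ x then F.orientation j.1 else 0)
  else (if F.left j.1 < x then -F.orientation j.1 else 0)

theorem abs_endCoeff_le (j : Fin n × Bool) (x : ℝ) : |F.endCoeff j x| ≤ 1 := by
  unfold endCoeff
  split_ifs <;> simp [abs_orientation]

open scoped Classical in
/-- The contribution of one first letter to the recursion. For `x` beyond the domain both endpoint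
values enter; for `x` inside, the left one and `f i x`. -/
theorem abs_lap_image_Iio_sub_le (i : Fin n) (x : ℝ) (m : ℕ) :
    |(F.lap (F.image i (Iio x)) m : ℝ) - (if x ∈ Ioo (F.left i) (F.right i) then
        F.orientation i * F.lap (Iio (F.f i x)) m else 0) -
      ∑ b : Bool, F.endCoeff (i, b) x * F.lap (Iio (F.endValue (i, b))) m| ≤
    (if x ∈ Ioo (F.left i) (F.right i) then F.lapAt (F.f i x) m else 0 : ℕ) +
      ∑ b : Bool, (F.lapAt (F.endValue (i, b)) m : ℝ) := by
  have hlr := F.left_lt_right i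
  simp only [Fintype.sum_bool, endCoeff, endValue, endpoint, if_true, Bool.false_eq_true, if_false]
  rcases le_or_gt x (F.left i) with h1 | h1
  · have hx : x ∉ Ioo (F.left i) (F.right i) := fun h => absurd h.1 h1.not_gt
    rw [image_of_disjoint, lap_empty, if_neg hx, if_neg hx, if_neg (by linarith),
      if_neg (by linarith)]
    · simp only [Nat.cast_zero, zero_mul, sub_zero, add_zero, abs_zero, zero_add]
      positivity
    · rw [Set.disjoint_left]
      exact fun y hy hy2 => absurd (hy2.1.trans_lt hy) h1.not_gt
  rcases lt_or_ge x (F.right i) with h2 | h2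
  · have hx : x ∈ Ioo (F.left i) (F.right i) := ⟨h1, h2⟩
    have hxI : x ∈ F.I i := Ioo_subset_Icc_self hx
    rw [F.image_Iio hxI, lap_sdiff_singleton, if_pos hx, if_pos hx, if_neg (by linarith),
      if_pos h1]
    have := F.abs_lap_uIcc_sub_le (F.left_mem i) hxI h1 m
    have h3 : (0 : ℝ) ≤ F.lapAt (F.f i (F.right i)) m := Nat.cast_nonneg _
    rw [abs_le] at this ⊢
    constructor <;> linarith [this.1, this.2]
  · have hx : x ∉ Ioo (F.left i) (F.right i) := fun h => absurd h.2 h2.not_gt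
    have him : F.lap (F.image i (Iio x)) m =
        F.lap (uIcc (F.f i (F.left i)) (F.f i (F.right i))) m := by
      rcases h2.eq_or_lt with h3 | h3
      · rw [← h3, F.image_Iio (F.right_mem i), lap_sdiff_singleton]
      · have hsub : F.I i ⊆ Iio x := fun y hy => hy.2.trans_lt h3
        rw [F.image_of_subset hsub]
    rw [him, if_neg hx, if_neg hx, if_pos h2, if_pos h1]
    have := F.abs_lap_uIcc_sub_le (F.left_mem i) (F.right_mem i) hlr m
    rw [abs_le] at this ⊢
    push_cast
    constructor <;> linarith [this.1, this.2]

/-- The defect in the linear recursion for `lap (Iio x)`: it counts words whose domain is cut. -/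
def defect (m : ℕ) (x : ℝ) : ℝ :=
  F.lap (Iio x) (m + 1) - F.transfer (fun y => F.lap (Iio y) m) x -
    ∑ j, F.endCoeff j x * F.lap (Iio (F.endValue j)) m

theorem abs_defect_le (m : ℕ) (x : ℝ) :
    |F.defect m x| ≤ F.lapAt x (m + 1) + ∑ j, (F.lapAt (F.endValue j) m : ℝ) := by
  classical
  rw [defect, transfer_apply, lap_succ, lapAt_succ, Fintype.sum_prod_type, Fintype.sum_prod_type]
  push_cast
  rw [← Finset.sum_sub_distrib, ← Finset.sum_sub_distrib, ← Finset.sum_add_distrib]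
  refine (Finset.abs_sum_le_sum_abs _ _).trans (Finset.sum_le_sum fun i _ => ?_)
  exact_mod_cast F.abs_lap_image_Iio_sub_le i x m

/-- The coefficients of the kneading power series expressing `L (Iio x)` through the
`L (Iio (endValue j))`. -/
def kneading (j : Fin n × Bool) (x : ℝ) (m : ℕ) : ℝ := (F.transfer ^ m) (F.endCoeff j) x

/-- The part of `lap (Iio x)` that is not explained by the values at the points `endValue j`. -/
def remainder (x : ℝ) (m : ℕ) : ℝ :=
  (F.transfer ^ (m + 1)) (fun y => F.lap (Iio y) 0) x +
    ∑ p ∈ antidiagonal m, (F.transfer ^ p.1) (F.defect p.2) x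

/-- The lap numbers of `Iio x` in terms of those of the half-lines at the points `endValue j`. -/
theorem lap_Iio_succ (x : ℝ) (m : ℕ) : (F.lap (Iio x) (m + 1) : ℝ) = F.remainder x m +
    ∑ j, ∑ p ∈ antidiagonal m, F.kneading j x p.1 * F.lap (Iio (F.endValue j)) p.2 := by
  have h := linear_recursion_eq F.transfer (fun m y => (F.lap (Iio y) m : ℝ))
    (fun m => F.defect m + ∑ j, (F.lap (Iio (F.endValue j)) m : ℝ) • F.endCoeff j) (fun m => by
      ext y
      simp only [Pi.add_apply, Finset.sum_apply, Pi.smul_apply, smul_eq_mul, defect]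
      simp only [mul_comm (F.endCoeff _ _)]
      ring) m
  have h' := congrFun h x
  simp only [Pi.add_apply, Finset.sum_apply, map_add, map_sum, map_smul, Pi.smul_apply,
    smul_eq_mul, Finset.sum_add_distrib] at h'
  rw [h', remainder, Finset.sum_comm, add_assoc]
  simp only [kneading, mul_comm]

variable {F}

theorem slowGrowth_kneading (hs : F.s₀ < F.s) {x : ℝ} (hx : x ∈ F.slowPoints)
    (j : Fin n × Bool) : SlowGrowth F.s (F.kneading j x) := by
  rw [F.mem_slowPoints_iff (F.s_pos hs)] at hx
  refine hx.mono fun m => ?_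
  have := F.abs_transfer_pow_le (φ := F.endCoeff j) (A := 0) (C := 1) (k := 0)
    (fun y => by simpa using F.abs_endCoeff_le j y) m x
  rw [Nat.abs_cast]
  simpa [kneading] using this

theorem slowGrowth_remainder (hs : F.s₀ < F.s) {x : ℝ} (hx : x ∈ F.slowPoints) :
    SlowGrowth F.s (F.remainder x) := by
  have hs0 := F.s_pos hs
  have hx' := (F.mem_slowPoints_iff hs0).1 hx
  have hv : SlowGrowth F.s fun m => ∑ j, (F.lapAt (F.endValue j) m : ℝ) :=
    SlowGrowth.sum hs0 _ fun j =>
      (F.mem_slowPoints_iff hs0).1 (F.endValue_mem_slowPoints hs j)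
  refine ((hx'.shift.add hx'.shift.linear_mul).add (hx'.convolution hv)).mono fun m => ?_
  have h1 := F.abs_transfer_pow_le (φ := fun y => F.lap (Iio y) 0) (A := 0) (C := 1) (k := 0)
    (fun y => by simpa using F.lap_zero_le (Iio y)) (m + 1) x
  have h2 : ∀ p ∈ antidiagonal m, |(F.transfer ^ p.1) (F.defect p.2) x| ≤
      F.lapAt x (m + 1) + F.lapAt x p.1 * ∑ j, (F.lapAt (F.endValue j) p.2 : ℝ) := by
    intro p hp
    have := F.abs_transfer_pow_le (φ := F.defect p.2) (A := 1) (k := p.2 + 1)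
      (fun y => by simpa using F.abs_defect_le p.2 y) p.1 x
    rw [← add_assoc, Finset.HasAntidiagonal.mem_antidiagonal.1 hp] at this
    linarith
  have h3 := (Finset.abs_sum_le_sum_abs _ _).trans (Finset.sum_le_sum h2)
  rw [Finset.sum_add_distrib, Finset.sum_const, Finset.Nat.card_antidiagonal, nsmul_eq_mul] at h3
  push_cast at h3
  refine le_trans ?_ (le_abs_self _)
  unfold remainder
  refine (abs_add_le _ _).trans ?_
  linarith

/-- All lap series converge in the open disk, as `lap univ` grows slower than `q ^ m`
for `s < q`. -/
theorem summable_lap (hs : 0 < F.s) (J : Set ℝ) {t : ℂ}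
    (ht : t ∈ Metric.ball (0 : ℂ) (1 / F.s)) :
    Summable fun m => ‖((F.lap J m : ℝ) : ℂ) * t ^ m‖ := by
  obtain ⟨q, hq, htq⟩ := exists_gt_norm_le_one_div hs ht
  exact (F.slowGrowth_lap (hs.trans hq) hq J).summable_norm htq

theorem summable_lap_succ (hs : 0 < F.s) (J : Set ℝ) {t : ℂ}
    (ht : t ∈ Metric.ball (0 : ℂ) (1 / F.s)) :
    Summable fun m => ‖((F.lap J (m + 1) : ℝ) : ℂ) * t ^ m‖ := by
  obtain ⟨q, hq, htq⟩ := exists_gt_norm_le_one_div hs ht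
  exact (F.slowGrowth_lap (hs.trans hq) hq J).shift.summable_norm htq

theorem tsum_lap (hs : 0 < F.s) (J : Set ℝ) {t : ℂ}
    (ht : t ∈ Metric.ball (0 : ℂ) (1 / F.s)) :
    ∑' m, ((F.lap J m : ℝ) : ℂ) * t ^ m = F.lap J 0 + t * F.L J t := by
  rw [(summable_lap hs J ht).of_norm.tsum_eq_zero_add, L, ← tsum_mul_left]
  simp only [pow_zero, mul_one, Complex.ofReal_natCast]
  congr 1
  exact tsum_congr fun m => by ring

theorem lap_Iio_zero (x : ℝ) : F.lap (Iio x) 0 = 1 := by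
  classical
  rw [lap_eq_sum, words_zero, Finset.sum_singleton, dom_nil, univ_inter, interior_Iio,
    if_pos nonempty_Iio]

/-- The generating function of the kneading coefficients. -/
def kneadingSeries (F : MonotoneSystem n) (j : Fin n × Bool) (x : ℝ) (t : ℂ) : ℂ :=
  ∑' m, (F.kneading j x m : ℂ) * t ^ m

theorem L_Iio_eq (hs : F.s₀ < F.s) {x : ℝ} (hx : x ∈ F.slowPoints) {t : ℂ}
    (ht : t ∈ Metric.ball (0 : ℂ) (1 / F.s)) :
    F.L (Iio x) t = ∑' m, (F.remainder x m : ℂ) * t ^ m +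
      ∑ j, F.kneadingSeries j x t * (1 + t * F.L (Iio (F.endValue j)) t) := by
  have hs0 := F.s_pos hs
  have htn : ‖t‖ ≤ 1 / F.s := (mem_ball_zero_iff.1 ht).le
  have hk := fun j => (slowGrowth_kneading hs hx j).summable_norm htn
  have hv := fun j => summable_lap hs0 (Iio (F.endValue j)) ht
  have hprod : ∀ j, F.kneadingSeries j x t * (1 + t * F.L (Iio (F.endValue j)) t) =
      ∑' m, ((∑ p ∈ antidiagonal m, F.kneading j x p.1 *
        F.lap (Iio (F.endValue j)) p.2 : ℝ) : ℂ) * t ^ m := by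
    intro j
    have h1 := tsum_lap hs0 (Iio (F.endValue j)) ht
    rw [lap_Iio_zero, Nat.cast_one] at h1
    rw [kneadingSeries, ← h1, tsum_mul_tsum_eq_tsum_sum_antidiagonal_of_summable_norm (hk j) (hv j)]
    refine tsum_congr fun m => ?_
    rw [Complex.ofReal_sum, Finset.sum_mul]
    refine Finset.sum_congr rfl fun p hp => ?_
    rw [← Finset.HasAntidiagonal.mem_antidiagonal.1 hp, pow_add]
    push_cast
    ring
  have hsum : ∀ j, Summable fun m => ((∑ p ∈ antidiagonal m, F.kneading j x p.1 *
        F.lap (Iio (F.endValue j)) p.2 : ℝ) : ℂ) * t ^ m := by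
    intro j
    obtain ⟨q, hq, htq⟩ := exists_gt_norm_le_one_div hs0 ht
    exact (((slowGrowth_kneading hs hx j).of_le hq.le).convolution
      (F.slowGrowth_lap (hs0.trans hq) hq _)).summable_norm htq |>.of_norm
  rw [Finset.sum_congr rfl fun j _ => hprod j, ← Summable.tsum_finsetSum fun j _ => hsum j,
    ← ((slowGrowth_remainder hs hx).summable_norm htn).of_norm.tsum_add
      (summable_sum fun j _ => hsum j), L]
  refine tsum_congr fun m => ?_
  have := F.lap_Iio_succ x m
  rw [← Complex.ofReal_natCast, this, ← Finset.sum_mul, ← add_mul]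
  push_cast
  rfl

/-- Meromorphic continuation across the circle of convergence, with a common denominator. -/
theorem exists_denominator (hs : F.s₀ < F.s) : ∃ d : ℂ → ℂ,
    AnalyticOnNhd ℂ d (Metric.closedBall 0 (1 / F.s)) ∧ d 0 = 1 ∧
    ∀ x ∈ F.slowPoints, ∃ h : ℂ → ℂ, AnalyticOnNhd ℂ h (Metric.closedBall 0 (1 / F.s)) ∧
      ∀ t ∈ Metric.ball (0 : ℂ) (1 / F.s), d t * F.L (Iio x) t = h t := by
  set U := Metric.closedBall (0 : ℂ) (1 / F.s)
  have hv := F.endValue_mem_slowPoints hs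
  have hK : ∀ x ∈ F.slowPoints, ∀ j, AnalyticOnNhd ℂ (F.kneadingSeries j x) U :=
    fun x hx j => (slowGrowth_kneading hs hx j).analyticOnNhd
  let c : ℝ → ℂ → ℂ := fun x t =>
    ∑' m, (F.remainder x m : ℂ) * t ^ m + ∑ j, F.kneadingSeries j x t
  have hc : ∀ x ∈ F.slowPoints, AnalyticOnNhd ℂ (c x) U := fun x hx =>
    (slowGrowth_remainder hs hx).analyticOnNhd.add
      (Finset.analyticOnNhd_fun_sum _ fun j _ => hK x hx j)
  let M : ℂ → Matrix (Fin n × Bool) (Fin n × Bool) ℂ := fun t =>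
    1 - t • Matrix.of fun i j => F.kneadingSeries j (F.endValue i) t
  have hM : ∀ i j, AnalyticOnNhd ℂ (fun t => M t i j) U := by
    intro i j
    simp only [M, Matrix.sub_apply, Matrix.smul_apply, Matrix.of_apply, smul_eq_mul]
    exact analyticOnNhd_const.sub (analyticOnNhd_id.mul (hK _ (hv i) j))
  have hd := AnalyticOnNhd.matrix_det hM
  have hL : ∀ x ∈ F.slowPoints, ∀ t ∈ Metric.ball (0 : ℂ) (1 / F.s), F.L (Iio x) t = c x t +
      t * ∑ j, F.kneadingSeries j x t * F.L (Iio (F.endValue j)) t := by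
    intro x hx t ht
    rw [L_Iio_eq hs hx ht, add_assoc, Finset.mul_sum, ← Finset.sum_add_distrib]
    congr 1
    exact Finset.sum_congr rfl fun j _ => by ring
  let H : Fin n × Bool → ℂ → ℂ := fun i t =>
    ∑ k, (M t).adjugate i k * c (F.endValue k) t
  have hH : ∀ i, AnalyticOnNhd ℂ (H i) U := fun i =>
    Finset.analyticOnNhd_fun_sum _ fun k _ =>
      (AnalyticOnNhd.matrix_adjugate hM i k).mul (hc _ (hv k))
  have hHL : ∀ i, ∀ t ∈ Metric.ball (0 : ℂ) (1 / F.s),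
      (M t).det * F.L (Iio (F.endValue i)) t = H i t := by
    intro i t ht
    have h1 : (M t).mulVec (fun j => F.L (Iio (F.endValue j)) t) =
        fun k => c (F.endValue k) t := by
      ext k
      rw [Matrix.sub_mulVec, Matrix.one_mulVec, Matrix.smul_mulVec, Pi.sub_apply,
        Pi.smul_apply, smul_eq_mul, hL _ (hv k) t ht]
      exact add_sub_cancel_right _ _
    have h2 := congrArg (fun w => (M t).adjugate.mulVec w i) h1
    simp only [Matrix.mulVec_mulVec, Matrix.adjugate_mul, Matrix.smul_mulVec,
      Matrix.one_mulVec, Pi.smul_apply, smul_eq_mul] at h2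
    exact h2
  refine ⟨fun t => (M t).det, hd, by simp [M], fun x hx => ?_⟩
  refine ⟨fun t => (M t).det * c x t + t * ∑ j, F.kneadingSeries j x t * H j t, ?_, ?_⟩
  · exact (hd.mul (hc x hx)).add (analyticOnNhd_id.mul
      (Finset.analyticOnNhd_fun_sum _ fun j _ => (hK x hx j).mul (hH j)))
  · intro t ht
    rw [hL x hx t ht, mul_add, mul_left_comm, Finset.mul_sum]
    congr 2
    refine Finset.sum_congr rfl fun j _ => ?_
    rw [← hHL j t ht]
    ring

end MonotoneSystem

/-! ### Densities -/

/-- A meromorphic function that stays bounded along the real axis has a limit. -/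
theorem MeromorphicAt.exists_tendsto_of_bounded {f : ℂ → ℂ} {τ : ℝ} (hf : MeromorphicAt f τ)
    {C : ℝ} (hC : ∀ᶠ t : ℝ in 𝓝[<] τ, ‖f t‖ ≤ C) : ∃ c, Tendsto f (𝓝[≠] (τ : ℂ)) (𝓝 c) := by
  rcases lt_or_ge (meromorphicOrderAt f τ) 0 with h | h
  · exfalso
    have h1 := tendsto_norm_cobounded_atTop.comp (tendsto_cobounded_of_meromorphicOrderAt_neg h)
    have h2 : Tendsto (fun t : ℝ => (t : ℂ)) (𝓝[<] τ) (𝓝[≠] (τ : ℂ)) := by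
      refine tendsto_nhdsWithin_iff.2 ⟨?_, ?_⟩
      · exact (Complex.continuous_ofReal.tendsto τ).mono_left nhdsWithin_le_nhds
      · filter_upwards [self_mem_nhdsWithin] with t ht
        simpa using (ne_of_lt ht : t ≠ τ)
    obtain ⟨t, ht1, ht2⟩ := (((h1.comp h2).eventually_gt_atTop C).and hC).exists
    exact absurd ht2 (not_le.2 ht1)
  · exact tendsto_nhds_of_meromorphicOrderAt_nonneg hf h

namespace MonotoneSystem

variable {n : ℕ} (F : MonotoneSystem n)

/-- The restriction of `L J` to the real axis. -/
def realL (J : Set ℝ) (t : ℝ) : ℝ := ∑' m : ℕ, (F.lap J (m + 1) : ℝ) * t ^ m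

theorem L_ofReal (J : Set ℝ) (t : ℝ) : F.L J t = F.realL J t := by
  rw [L, realL, Complex.ofReal_tsum]
  exact tsum_congr fun m => by push_cast; rfl

variable {F}

theorem ofReal_mem_ball {t : ℝ} (ht : t ∈ Ioo 0 (1 / F.s)) :
    (t : ℂ) ∈ Metric.ball (0 : ℂ) (1 / F.s) := by
  rw [mem_ball_zero_iff, Complex.norm_real, Real.norm_eq_abs, abs_of_pos ht.1]
  exact ht.2

theorem summable_realL (hs : 0 < F.s) (J : Set ℝ) {t : ℝ} (ht : t ∈ Ioo 0 (1 / F.s)) :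
    Summable fun m => (F.lap J (m + 1) : ℝ) * t ^ m := by
  have := summable_lap_succ hs J (ofReal_mem_ball ht)
  refine this.congr fun m => ?_
  rw [norm_mul, norm_pow, Complex.norm_real, Complex.norm_real, Real.norm_eq_abs, Nat.abs_cast,
    Real.norm_eq_abs, abs_of_pos ht.1]

theorem realL_nonneg (J : Set ℝ) {t : ℝ} (ht : t ∈ Ioo 0 (1 / F.s)) : 0 ≤ F.realL J t :=
  tsum_nonneg fun _ => mul_nonneg (Nat.cast_nonneg _) (pow_nonneg ht.1.le _)

theorem realL_mono (hs : 0 < F.s) {J K : Set ℝ} (h : J ⊆ K) {t : ℝ}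
    (ht : t ∈ Ioo 0 (1 / F.s)) : F.realL J t ≤ F.realL K t :=
  (summable_realL hs J ht).tsum_le_tsum (fun m => mul_le_mul_of_nonneg_right
    (by exact_mod_cast F.lap_mono h _) (pow_nonneg ht.1.le _)) (summable_realL hs K ht)

theorem realL_le_add (hs : 0 < F.s) (J : Set ℝ) (x : ℝ) {t : ℝ} (ht : t ∈ Ioo 0 (1 / F.s)) :
    F.realL J t ≤ F.realL (J ∩ Iio x) t + F.realL (J ∩ Ioi x) t := by
  rw [realL, realL, realL, ← (summable_realL hs _ ht).tsum_add (summable_realL hs _ ht)]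
  refine (summable_realL hs J ht).tsum_le_tsum (fun m => ?_)
    ((summable_realL hs _ ht).add (summable_realL hs _ ht))
  rw [← add_mul]
  exact mul_le_mul_of_nonneg_right (by exact_mod_cast F.lap_le_add J x _) (pow_nonneg ht.1.le _)

theorem div_one_sub_le_realL (hs : 0 < F.s) {t : ℝ} (ht : t ∈ Ioo 0 (1 / F.s)) :
    F.s * (1 - F.s * t)⁻¹ ≤ F.realL univ t := by
  have h1 : F.s * t < 1 := by
    rw [mul_comm, ← lt_div_iff₀ hs]; exact ht.2
  have h0 : 0 ≤ F.s * t := mul_nonneg hs.le ht.1.le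
  rw [← tsum_geometric_of_lt_one h0 h1, ← tsum_mul_left]
  refine ((summable_geometric_of_lt_one h0 h1).mul_left F.s).tsum_le_tsum (fun m => ?_)
    (summable_realL hs _ ht)
  calc F.s * (F.s * t) ^ m = F.s ^ (m + 1) * t ^ m := by rw [mul_pow, pow_succ]; ring
    _ ≤ _ := mul_le_mul_of_nonneg_right (F.s_pow_le_lap hs _) (pow_nonneg ht.1.le _)

theorem realL_univ_pos (hs : 0 < F.s) {t : ℝ} (ht : t ∈ Ioo 0 (1 / F.s)) :
    0 < F.realL univ t := by
  refine lt_of_lt_of_le (mul_pos hs (inv_pos.2 ?_)) (div_one_sub_le_realL hs ht)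
  rw [sub_pos, mul_comm, ← lt_div_iff₀ hs]
  exact ht.2

theorem eventually_mem_Ioo (hs : 0 < F.s) : ∀ᶠ t : ℝ in 𝓝[<] (1 / F.s), t ∈ Ioo 0 (1 / F.s) :=
  Ioo_mem_nhdsLT (by positivity)

theorem tendsto_realL_univ (hs : 0 < F.s) :
    Tendsto (F.realL univ) (𝓝[<] (1 / F.s)) atTop := by
  refine tendsto_atTop_mono' _ ((eventually_mem_Ioo hs).mono fun t ht =>
    div_one_sub_le_realL hs ht) ?_
  refine Tendsto.const_mul_atTop hs (tendsto_inv_nhdsGT_zero.comp ?_)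
  refine tendsto_nhdsWithin_iff.2 ⟨?_, ?_⟩
  · have : Tendsto (fun t => 1 - F.s * t) (𝓝 (1 / F.s)) (𝓝 (1 - F.s * (1 / F.s))) := by
      apply Continuous.tendsto; fun_prop
    rw [mul_one_div_cancel hs.ne', sub_self] at this
    exact this.mono_left nhdsWithin_le_nhds
  · filter_upwards [eventually_mem_Ioo hs] with t ht
    rw [mem_Ioi, sub_pos, mul_comm, ← lt_div_iff₀ hs]
    exact ht.2

theorem realL_div_le_one (hs : 0 < F.s) (J : Set ℝ) {t : ℝ} (ht : t ∈ Ioo 0 (1 / F.s)) :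
    F.realL J t / F.realL univ t ≤ 1 :=
  (div_le_one (realL_univ_pos hs ht)).2 (realL_mono hs (subset_univ _) ht)

theorem realL_div_nonneg (J : Set ℝ) {t : ℝ} (ht : t ∈ Ioo 0 (1 / F.s)) :
    0 ≤ F.realL J t / F.realL univ t :=
  div_nonneg (realL_nonneg J ht) (realL_nonneg univ ht)

/-- By submultiplicativity of lap numbers, the asymptotic density of `J` is at most
`lap J m / s ^ m`, for each `m`. -/
theorem realL_div_le (hs : 0 < F.s) (m : ℕ) : ∃ K, ∀ J, ∀ t ∈ Ioo 0 (1 / F.s),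
    F.realL J t / F.realL univ t ≤ K * (F.realL univ t)⁻¹ + F.lap J m * (1 / F.s) ^ m := by
  refine ⟨∑ k ∈ Finset.range m, F.lap univ (k + 1) * (1 / F.s) ^ k, fun J t ht => ?_⟩
  have hpos := realL_univ_pos hs ht
  rw [div_le_iff₀ hpos, add_mul, inv_mul_cancel_right₀ hpos.ne']
  have hsum := summable_realL hs J ht
  have hsplit := hsum.sum_add_tsum_nat_add m
  rw [realL, ← hsplit]
  refine add_le_add (Finset.sum_le_sum fun k _ => ?_) ?_
  · refine mul_le_mul (by exact_mod_cast F.lap_mono (subset_univ _) _)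
      (pow_le_pow_left₀ ht.1.le ht.2.le k) (pow_nonneg ht.1.le _) (Nat.cast_nonneg _)
  · rw [realL, ← tsum_mul_left]
    refine ((summable_nat_add_iff m).2 hsum).tsum_le_tsum (fun k => ?_)
      ((summable_realL hs univ ht).mul_left _)
    have h1 : (F.lap J (k + m + 1) : ℝ) ≤ F.lap J m * F.lap univ (k + 1) := by
      rw [show k + m + 1 = m + (k + 1) by ring]
      exact_mod_cast F.lap_add_le_mul J m (k + 1)
    calc (F.lap J (k + m + 1) : ℝ) * t ^ (k + m)
        ≤ (F.lap J m * F.lap univ (k + 1)) * ((1 / F.s) ^ m * t ^ k) := by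
          rw [pow_add, mul_comm (t ^ k)]
          exact mul_le_mul h1 (mul_le_mul_of_nonneg_right
            (pow_le_pow_left₀ ht.1.le ht.2.le m) (pow_nonneg ht.1.le _))
            (by have := ht.1.le; positivity) (by positivity)
      _ = _ := by ring

variable (F) in
/-- The set `J` has density `c` if `L J t / L univ t` tends to `c` as `t → 1 / s` in the disk of
convergence. -/
def HasDensity (J : Set ℝ) (c : ℝ) : Prop :=
  Tendsto (fun t : ℂ => F.L J t / F.L univ t)
    (𝓝[Metric.ball (0 : ℂ) (1 / F.s)] ((1 / F.s : ℝ) : ℂ)) (𝓝 (c : ℂ))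

theorem tendsto_ofReal_ball (hs : 0 < F.s) : Tendsto (fun t : ℝ => (t : ℂ)) (𝓝[<] (1 / F.s))
    (𝓝[Metric.ball (0 : ℂ) (1 / F.s)] ((1 / F.s : ℝ) : ℂ)) := by
  refine tendsto_nhdsWithin_iff.2 ⟨?_, ?_⟩
  · exact (Complex.continuous_ofReal.tendsto _).mono_left nhdsWithin_le_nhds
  · filter_upwards [eventually_mem_Ioo hs] with t ht using ofReal_mem_ball ht

theorem ball_le_punctured : 𝓝[Metric.ball (0 : ℂ) (1 / F.s)] ((1 / F.s : ℝ) : ℂ) ≤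
    𝓝[≠] ((1 / F.s : ℝ) : ℂ) := by
  refine nhdsWithin_mono _ fun t ht h => ?_
  rw [mem_singleton_iff] at h
  rw [h, mem_ball_zero_iff, Complex.norm_real] at ht
  exact absurd ht (not_lt.2 (le_abs_self _))

theorem HasDensity.tendsto_real (hs : 0 < F.s) {J : Set ℝ} {c : ℝ} (h : F.HasDensity J c) :
    Tendsto (fun t => F.realL J t / F.realL univ t) (𝓝[<] (1 / F.s)) (𝓝 c) := by
  have h1 := (Complex.continuous_re.tendsto _).comp (h.comp (tendsto_ofReal_ball hs))
  refine h1.congr fun t => ?_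
  simp only [Function.comp, L_ofReal]
  rw [← Complex.ofReal_div, Complex.ofReal_re]

theorem HasDensity.unique (hs : 0 < F.s) {J : Set ℝ} {c c' : ℝ} (h : F.HasDensity J c)
    (h' : F.HasDensity J c') : c = c' :=
  tendsto_nhds_unique (h.tendsto_real hs) (h'.tendsto_real hs)

theorem L_congr {J K : Set ℝ} (h : ∀ m, F.lap J (m + 1) = F.lap K (m + 1)) (t : ℂ) :
    F.L J t = F.L K t := by
  simp only [L, h]

theorem HasDensity.congr {J K : Set ℝ} {c : ℝ} (h : ∀ m, F.lap J (m + 1) = F.lap K (m + 1))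
    (hJ : F.HasDensity J c) : F.HasDensity K c := by
  unfold HasDensity at hJ ⊢
  simpa only [L_congr h] using hJ

theorem hasDensity_empty : F.HasDensity ∅ 0 := by
  unfold HasDensity
  simpa [L, lap_empty] using tendsto_const_nhds

theorem one_div_s_mem (hs : 0 < F.s) :
    ((1 / F.s : ℝ) : ℂ) ∈ Metric.closedBall (0 : ℂ) (1 / F.s) := by
  rw [mem_closedBall_zero_iff, Complex.norm_real, Real.norm_eq_abs, abs_of_pos (by positivity)]

theorem image_eq_of_inter {J : Set ℝ} {K : Set ℝ} (h : ∀ i, F.I i ⊆ K) (i : Fin n) :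
    F.image i (J ∩ K) = F.image i J := by
  rw [image, image, inter_assoc, inter_eq_self_of_subset_right (h i)]

theorem lap_succ_inter {J K : Set ℝ} (h : ∀ i, F.I i ⊆ K) (m : ℕ) :
    F.lap (J ∩ K) (m + 1) = F.lap J (m + 1) := by
  simp only [lap_succ, image_eq_of_inter h]

/-- The two consequences of meromorphic continuation: half-lines with slow endpoint have a density,
and `L univ` has a pole at `1 / s`. -/
theorem exists_hasDensity_Iio_and_tendsto (hs : F.s₀ < F.s) :
    (∀ x ∈ F.slowPoints, ∃ c, F.HasDensity (Iio x) c) ∧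
    Tendsto (fun t : ℂ => (F.L univ t)⁻¹)
      (𝓝[Metric.ball (0 : ℂ) (1 / F.s)] ((1 / F.s : ℝ) : ℂ)) (𝓝 0) := by
  have hs0 := F.s_pos hs
  have hτ := one_div_s_mem hs0
  obtain ⟨d, hd, hd0, hh⟩ := exists_denominator hs
  obtain ⟨a, -, b, hb, -, hab⟩ := F.exists_bounds hs0
  have huniv : ∀ t, F.L univ t = F.L (Iio b) t := by
    refine fun t => L_congr (fun m => ?_) t
    rw [← F.lap_succ_inter (J := univ) (K := Iio b) fun i x hx => (hab i hx).2, univ_inter]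
  obtain ⟨u, hu, hLu⟩ := hh b hb
  have hne : ∀ᶠ t in 𝓝[Metric.ball (0 : ℂ) (1 / F.s)] ((1 / F.s : ℝ) : ℂ), d t ≠ 0 := by
    refine ball_le_punctured ?_
    by_contra hcon
    have hfreq : ∃ᶠ t in 𝓝[≠] ((1 / F.s : ℝ) : ℂ), d t = 0 :=
      (not_eventually.1 hcon).mono fun t ht => not_not.1 ht
    have := hd.eqOn_zero_of_preconnected_of_frequently_eq_zero
      (convex_closedBall _ _).isPreconnected hτ hfreq
      (Metric.mem_closedBall_self (by positivity : (0 : ℝ) ≤ 1 / F.s))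
    rw [hd0] at this
    exact one_ne_zero this
  have hev : ∀ x ∈ F.slowPoints, ∃ h : ℂ → ℂ, MeromorphicAt h ((1 / F.s : ℝ) : ℂ) ∧
      ∀ᶠ t in 𝓝[Metric.ball (0 : ℂ) (1 / F.s)] ((1 / F.s : ℝ) : ℂ),
        F.L (Iio x) t / F.L univ t = h t := by
    intro x hx
    obtain ⟨h, hh1, hh2⟩ := hh x hx
    refine ⟨fun t => h t / u t, (hh1 _ hτ).meromorphicAt.fun_div (hu _ hτ).meromorphicAt, ?_⟩
    filter_upwards [hne, self_mem_nhdsWithin] with t ht htb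
    rw [huniv, ← hh2 t htb, ← hLu t htb, mul_div_mul_left _ _ ht]
  have hinv : ∀ᶠ t in 𝓝[Metric.ball (0 : ℂ) (1 / F.s)] ((1 / F.s : ℝ) : ℂ),
      (F.L univ t)⁻¹ = d t / u t := by
    filter_upwards [hne, self_mem_nhdsWithin] with t ht htb
    rw [huniv, ← hLu t htb, div_mul_cancel_left₀ ht]
  refine ⟨fun x hx => ?_, ?_⟩
  · obtain ⟨h, hh1, hh2⟩ := hev x hx
    have hreal : ∀ᶠ t : ℝ in 𝓝[<] (1 / F.s),
        h t = ((F.realL (Iio x) t / F.realL univ t : ℝ) : ℂ) := by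
      filter_upwards [(tendsto_ofReal_ball hs0).eventually hh2] with t ht
      rw [← ht, L_ofReal, L_ofReal, Complex.ofReal_div]
    obtain ⟨c, hc⟩ := hh1.exists_tendsto_of_bounded (C := 1) (by
      filter_upwards [hreal, eventually_mem_Ioo hs0] with t ht htI
      rw [ht, Complex.norm_real, Real.norm_eq_abs, abs_of_nonneg (realL_div_nonneg _ htI)]
      exact realL_div_le_one hs0 _ htI)
    have hc' := hc.mono_left (ball_le_punctured (F := F))
    refine ⟨c.re, ?_⟩
    -- the limit is real because it is attained along the real axis
    have him : c.im = 0 := by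
      have h1 := (Complex.continuous_im.tendsto _).comp (hc'.comp (tendsto_ofReal_ball hs0))
      refine tendsto_nhds_unique h1 (tendsto_const_nhds.congr' ?_)
      filter_upwards [hreal] with t ht
      simp only [Function.comp, ht, Complex.ofReal_im]
    have hcr : (c.re : ℂ) = c := Complex.ext rfl (by simp [him])
    rw [HasDensity, hcr]
    exact hc'.congr' (hh2.mono fun t ht => ht.symm)
  · have hmer : MeromorphicAt (fun t => d t / u t) ((1 / F.s : ℝ) : ℂ) :=
      (hd _ hτ).meromorphicAt.fun_div (hu _ hτ).meromorphicAt
    have hreal : Tendsto (fun t : ℝ => d t / u t) (𝓝[<] (1 / F.s)) (𝓝 0) := by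
      have h1 := (tendsto_inv_atTop_zero.comp (tendsto_realL_univ hs0)).ofReal
      refine Tendsto.congr' ?_ (by simpa using h1)
      filter_upwards [(tendsto_ofReal_ball hs0).eventually hinv] with t ht
      rw [← ht, L_ofReal]
    obtain ⟨c, hc⟩ := hmer.exists_tendsto_of_bounded (C := 1) (by
      have := hreal.norm
      rw [norm_zero] at this
      exact (this.eventually_lt_const one_pos).mono fun t ht => ht.le)
    have hc' := hc.mono_left (ball_le_punctured (F := F))
    have hc0 : c = 0 := tendsto_nhds_unique (hc'.comp (tendsto_ofReal_ball hs0)) hreal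
    rw [hc0] at hc'
    exact hc'.congr' (hinv.mono fun t ht => ht.symm)

theorem summable_natCast_lap (hs : 0 < F.s) (J : Set ℝ) {t : ℂ}
    (ht : t ∈ Metric.ball (0 : ℂ) (1 / F.s)) :
    Summable fun m => (F.lap J (m + 1) : ℂ) * t ^ m := by
  simpa using (summable_lap_succ hs J ht).of_norm

/-- Densities only depend on lap numbers up to slowly growing errors. -/
theorem HasDensity.add_mul_of_slowGrowth (hs : F.s₀ < F.s) {J K₁ K₂ : Set ℝ} {c₁ c₂ r : ℝ}
    (h₁ : F.HasDensity K₁ c₁) (h₂ : F.HasDensity K₂ c₂)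
    (h : SlowGrowth F.s fun m => (F.lap J m : ℝ) - (F.lap K₁ m + r * F.lap K₂ m)) :
    F.HasDensity J (c₁ + r * c₂) := by
  have hs0 := F.s_pos hs
  have hE := (h.shift.analyticOnNhd _ (one_div_s_mem hs0)).continuousAt.tendsto.mono_left
    (nhdsWithin_le_nhds (s := Metric.ball (0 : ℂ) (1 / F.s)))
  have hlim := (h₁.add (h₂.const_mul (r : ℂ))).add
    (hE.mul (exists_hasDensity_Iio_and_tendsto hs).2)
  rw [mul_zero, add_zero] at hlim
  unfold HasDensity
  push_cast at hlim ⊢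
  refine hlim.congr' ?_
  filter_upwards [self_mem_nhdsWithin] with t ht
  have hsE := (h.shift.summable_norm (mem_ball_zero_iff.1 ht).le).of_norm
  have h1 := summable_natCast_lap hs0 K₁ ht
  have h2 := summable_natCast_lap hs0 K₂ ht
  have hL : F.L J t = F.L K₁ t + r * F.L K₂ t + ∑' m, (((F.lap J (m + 1) : ℝ) -
      (F.lap K₁ (m + 1) + r * F.lap K₂ (m + 1)) : ℝ) : ℂ) * t ^ m := by
    rw [L, L, L, ← tsum_mul_left, ← h1.tsum_add (h2.mul_left _),
      ← (h1.add (h2.mul_left _)).tsum_add hsE]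
    refine tsum_congr fun m => ?_
    push_cast
    ring
  rw [hL]
  push_cast
  ring

theorem hasDensity_Ioo (hs : F.s₀ < F.s) {a b ca cb : ℝ} (ha : a ∈ F.slowPoints) (hab : a < b)
    (hca : F.HasDensity (Iio a) ca) (hcb : F.HasDensity (Iio b) cb) :
    F.HasDensity (Ioo a b) (cb - ca) := by
  have := hcb.add_mul_of_slowGrowth hs hca (r := -1) (J := Ioo a b)
    (((F.mem_slowPoints_iff (F.s_pos hs)).1 ha).mono fun m => by
      rw [Nat.abs_cast, neg_one_mul, ← sub_eq_add_neg]
      exact F.abs_lap_Ioo_sub_le hab m)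
  rwa [neg_one_mul, ← sub_eq_add_neg] at this

theorem HasDensity.split (hs : F.s₀ < F.s) {J : Set ℝ} {p c₁ c₂ : ℝ} (hp : p ∈ F.slowPoints)
    (h₁ : F.HasDensity (J ∩ Iio p) c₁) (h₂ : F.HasDensity (J ∩ Ioi p) c₂) :
    F.HasDensity J (c₁ + c₂) := by
  have := h₁.add_mul_of_slowGrowth hs h₂ (r := 1) (J := J)
    (((F.mem_slowPoints_iff (F.s_pos hs)).1 hp).mono fun m => by
      rw [Nat.abs_cast, one_mul]
      have h1 : (F.lap J m : ℝ) ≤ F.lap (J ∩ Iio p) m + F.lap (J ∩ Ioi p) m := by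
        exact_mod_cast F.lap_le_add J p m
      have h2 : (F.lap (J ∩ Iio p) m : ℝ) + F.lap (J ∩ Ioi p) m ≤ F.lap J m + F.lapAt p m := by
        exact_mod_cast F.lap_add_le J p m
      rw [abs_le]
      constructor <;> linarith [(Nat.cast_nonneg (F.lapAt p m) : (0 : ℝ) ≤ _)])
  rwa [one_mul] at this

/-- The scaling relation for densities. -/
theorem hasDensity_of_image (hs : F.s₀ < F.s) {J : Set ℝ} {c : Fin n → ℝ}
    (h : ∀ i, F.HasDensity (F.image i J) (c i)) : F.HasDensity J (1 / F.s * ∑ i, c i) := by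
  have hs0 := F.s_pos hs
  have hinv := (exists_hasDensity_Iio_and_tendsto hs).2
  have hsum := tendsto_finsetSum Finset.univ fun i _ => h i
  have hid : Tendsto (fun t : ℂ => t) (𝓝[Metric.ball (0 : ℂ) (1 / F.s)] ((1 / F.s : ℝ) : ℂ))
      (𝓝 ((1 / F.s : ℝ) : ℂ)) := tendsto_id.mono_left nhdsWithin_le_nhds
  have hlim := (hinv.const_mul (F.lap J 1 : ℂ)).add (hid.mul hsum)
  rw [mul_zero, zero_add] at hlim
  unfold HasDensity
  push_cast at hlim ⊢
  refine hlim.congr' ?_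
  filter_upwards [self_mem_nhdsWithin] with t ht
  have h1 : F.L J t = F.lap J 1 + t * ∑ i, F.L (F.image i J) t := by
    have h2 : ∀ i, ∑' m, (F.lap (F.image i J) m : ℂ) * t ^ m =
        F.lap (F.image i J) 0 + t * F.L (F.image i J) t := fun i => by
      simpa using tsum_lap hs0 (F.image i J) ht
    have h3 : ∀ i, Summable fun m => (F.lap (F.image i J) m : ℂ) * t ^ m := fun i => by
      simpa using (summable_lap hs0 (F.image i J) ht).of_norm
    calc F.L J t = ∑' m, ∑ i, (F.lap (F.image i J) m : ℂ) * t ^ m := by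
          rw [L]
          refine tsum_congr fun m => ?_
          rw [lap_succ, ← Finset.sum_mul]
          push_cast
          rfl
      _ = _ := by
          rw [Summable.tsum_finsetSum fun i _ => h3 i, Finset.sum_congr rfl fun i _ => h2 i,
            Finset.sum_add_distrib, ← Finset.mul_sum, ← zero_add 1, lap_succ]
          push_cast
          rfl
  rw [h1, add_div, div_eq_mul_inv, mul_div_assoc, Finset.sum_div]

end MonotoneSystem

/-! ### The measure -/

theorem IsPreconnected.subset_or_disjoint_of_frontier {X : Type*} [TopologicalSpace X]
    {C J : Set X} (hC : IsPreconnected C) (h : Disjoint C (frontier J)) :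
    C ⊆ J ∨ Disjoint C J := by
  have hcover : C ⊆ interior J ∪ (closure J)ᶜ := by
    intro x hx
    by_cases h1 : x ∈ closure J
    · by_cases h2 : x ∈ interior J
      · exact Or.inl h2
      · exact absurd ⟨h1, h2⟩ (Set.disjoint_left.1 h hx)
    · exact Or.inr h1
  rcases (C ∩ (closure J)ᶜ).eq_empty_or_nonempty with h1 | h1
  · left
    intro x hx
    rcases hcover hx with h2 | h2
    · exact interior_subset h2
    · exact absurd (h1 ▸ ⟨hx, h2⟩ : x ∈ (∅ : Set X)) (notMem_empty x)
  · right
    rw [Set.disjoint_left]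
    intro x hx hxJ
    have h2 : (C ∩ interior J).Nonempty := by
      rcases hcover hx with h3 | h3
      · exact ⟨x, hx, h3⟩
      · exact absurd (subset_closure hxJ) h3
    obtain ⟨y, -, hy1, hy2⟩ := hC _ _ isOpen_interior isClosed_closure.isOpen_compl hcover h2 h1
    exact hy2 (interior_subset.trans subset_closure hy1)

namespace MonotoneSystem

variable {n : ℕ} {F : MonotoneSystem n}

variable (F) in
/-- The distribution function of the measure to be constructed: the upper density of the half-line
`Iio x`, which makes sense also when `x` is not slow. -/
def dist (x : ℝ) : ℝ :=
  limsup (fun t => F.realL (Iio x) t / F.realL univ t) (𝓝[<] (1 / F.s))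

theorem isBoundedUnder_le (hs : 0 < F.s) (J : Set ℝ) :
    IsBoundedUnder (· ≤ ·) (𝓝[<] (1 / F.s)) fun t => F.realL J t / F.realL univ t :=
  isBoundedUnder_of_eventually_le ((eventually_mem_Ioo hs).mono fun _ ht =>
    realL_div_le_one hs J ht)

theorem isBoundedUnder_ge (hs : 0 < F.s) (J : Set ℝ) :
    IsBoundedUnder (· ≥ ·) (𝓝[<] (1 / F.s)) fun t => F.realL J t / F.realL univ t :=
  isBoundedUnder_of_eventually_ge ((eventually_mem_Ioo hs).mono fun _ ht =>
    realL_div_nonneg J ht)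

theorem monotone_dist (hs : 0 < F.s) : Monotone F.dist := by
  intro x y hxy
  refine limsup_le_limsup ?_ (isBoundedUnder_ge hs _).isCoboundedUnder_le (isBoundedUnder_le hs _)
  filter_upwards [eventually_mem_Ioo hs] with t ht
  exact div_le_div_of_nonneg_right (realL_mono hs (Iio_subset_Iio hxy) ht) (realL_nonneg _ ht)

theorem HasDensity.dist_eq (hs : 0 < F.s) {x c : ℝ} (h : F.HasDensity (Iio x) c) :
    F.dist x = c :=
  (h.tendsto_real hs).limsup_eq

theorem hasDensity_Iio (hs : F.s₀ < F.s) {x : ℝ} (hx : x ∈ F.slowPoints) :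
    F.HasDensity (Iio x) (F.dist x) := by
  obtain ⟨c, hc⟩ := (exists_hasDensity_Iio_and_tendsto hs).1 x hx
  rwa [hc.dist_eq (F.s_pos hs)]

theorem abs_dist_le (hs : 0 < F.s) (x : ℝ) : |F.dist x| ≤ 1 := by
  rw [abs_le]
  constructor
  · refine le_trans (by norm_num : (-1 : ℝ) ≤ 0) (le_limsup_of_frequently_le ?_
      (isBoundedUnder_le hs _))
    exact ((eventually_mem_Ioo hs).mono fun t ht => realL_div_nonneg _ ht).frequently
  · exact limsup_le_of_le (isBoundedUnder_ge hs _).isCoboundedUnder_le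
      ((eventually_mem_Ioo hs).mono fun t ht => realL_div_le_one hs _ ht)

/-- The distribution function is continuous at slow points, because only `fatCount y m = o(s ^ m)`
words of length `m` are seen in small neighbourhoods of a slow point `y`. -/
theorem continuousAt_dist (hs : F.s₀ < F.s) {y : ℝ} (hy : y ∈ F.slowPoints) :
    ContinuousAt F.dist y := by
  have hs0 := F.s_pos hs
  rw [Metric.continuousAt_iff]
  intro ε hε
  obtain ⟨m, hm⟩ :=
    ((F.slowGrowth_fatCount hs hy).tendsto_div.eventually_lt_const hε).exists
  obtain ⟨δ, hδ, hlap⟩ := F.exists_lap_Ioo_le y m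
  refine ⟨δ, hδ, fun {x} hx => ?_⟩
  set J := Ioo (y - δ) (y + δ)
  have hsmall : (F.lap J m : ℝ) * (1 / F.s) ^ m < ε := by
    refine lt_of_le_of_lt ?_ hm
    rw [one_div, inv_pow, div_eq_mul_inv]
    exact mul_le_mul_of_nonneg_right (by exact_mod_cast hlap) (by positivity)
  obtain ⟨K, hK⟩ := realL_div_le hs0 m
  have hlim : Tendsto (fun t => K * (F.realL univ t)⁻¹ + (F.lap J m : ℝ) * (1 / F.s) ^ m)
      (𝓝[<] (1 / F.s)) (𝓝 (F.lap J m * (1 / F.s) ^ m)) := by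
    simpa using ((tendsto_inv_atTop_zero.comp (tendsto_realL_univ hs0)).const_mul K).add_const
      ((F.lap J m : ℝ) * (1 / F.s) ^ m)
  have hcmp : ∀ a b, y - δ < a → a ≤ b → b < y + δ → ∀ t ∈ Ioo 0 (1 / F.s),
      F.realL (Iio b) t / F.realL univ t ≤ F.realL (Iio a) t / F.realL univ t +
        (K * (F.realL univ t)⁻¹ + F.lap J m * (1 / F.s) ^ m) := by
    intro a b h1 h2 h3 t ht
    have h4 := realL_le_add hs0 (Iio b) a ht
    have h5 : F.realL (Iio b ∩ Iio a) t ≤ F.realL (Iio a) t :=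
      realL_mono hs0 inter_subset_right ht
    have h6 : F.realL (Iio b ∩ Ioi a) t ≤ F.realL J t :=
      realL_mono hs0 (show Iio b ∩ Ioi a ⊆ Ioo (y - δ) (y + δ) from
        fun z hz => ⟨h1.trans hz.2, lt_trans hz.1 h3⟩) ht
    have h7 := hK J t ht
    have h8 : F.realL (Iio b) t / F.realL univ t ≤
        F.realL (Iio a) t / F.realL univ t + F.realL J t / F.realL univ t := by
      rw [← add_div]
      exact div_le_div_of_nonneg_right (by linarith) (realL_nonneg _ ht)
    linarith
  have hy' := (hasDensity_Iio hs hy).tendsto_real hs0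
  rw [Real.dist_eq] at hx ⊢
  rw [abs_lt] at hx
  rcases le_total x y with hxy | hxy
  · have h1 := monotone_dist hs0 hxy
    rw [abs_of_nonpos (by linarith)]
    have h2 : F.dist y - F.lap J m * (1 / F.s) ^ m ≤ F.dist x := by
      rw [← (hy'.sub hlim).limsup_eq]
      refine limsup_le_limsup ?_ (hy'.sub hlim).isBoundedUnder_ge.isCoboundedUnder_le
        (isBoundedUnder_le hs0 _)
      filter_upwards [eventually_mem_Ioo hs0] with t ht
      linarith [hcmp x y (by linarith) hxy (by linarith) t ht]
    linarith
  · have h1 := monotone_dist hs0 hxy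
    rw [abs_of_nonneg (by linarith)]
    have h2 : F.dist x ≤ F.dist y + F.lap J m * (1 / F.s) ^ m := by
      rw [← (hy'.add hlim).limsup_eq]
      refine limsup_le_limsup ?_ (isBoundedUnder_ge hs0 _).isCoboundedUnder_le
        (hy'.add hlim).isBoundedUnder_le
      filter_upwards [eventually_mem_Ioo hs0] with t ht
      exact hcmp y x (by linarith) hxy (by linarith) t ht
    linarith

theorem stieltjes_eq (hs : F.s₀ < F.s) {p : ℝ} (hp : p ∈ F.slowPoints) :
    (monotone_dist (F.s_pos hs)).stieltjesFunction p = F.dist p := by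
  rw [Monotone.stieltjesFunction_eq]
  exact rightLim_eq_of_tendsto ((continuousAt_dist hs hp).tendsto.mono_left nhdsWithin_le_nhds)

theorem leftLim_stieltjes_eq (hs : F.s₀ < F.s) {p : ℝ} (hp : p ∈ F.slowPoints) :
    Function.leftLim (monotone_dist (F.s_pos hs)).stieltjesFunction p = F.dist p := by
  have hmono := monotone_dist (F.s_pos hs)
  refine leftLim_eq_of_tendsto (tendsto_of_tendsto_of_tendsto_of_le_of_le'
    ((continuousAt_dist hs hp).tendsto.mono_left nhdsWithin_le_nhds) tendsto_const_nhds ?_ ?_)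
  · exact Eventually.of_forall fun x => hmono.le_rightLim le_rfl
  · filter_upwards [self_mem_nhdsWithin] with x hx
    exact hmono.rightLim_le hx

variable (F) in
/-- Boolean combinations of half-lines with slow endpoints, described by what is used about them:
measurability and a finite boundary consisting of slow points. -/
def IsSlowSet (J : Set ℝ) : Prop :=
  MeasurableSet[F.slowSigma] J ∧ ∃ P : Finset ℝ, ↑P ⊆ F.slowPoints ∧ frontier J ⊆ P

theorem IsSlowSet.compl {J : Set ℝ} (h : F.IsSlowSet J) : F.IsSlowSet Jᶜ :=
  ⟨h.1.compl, by rw [frontier_compl]; exact h.2⟩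

theorem IsSlowSet.union {J K : Set ℝ} (hJ : F.IsSlowSet J) (hK : F.IsSlowSet K) :
    F.IsSlowSet (J ∪ K) := by
  classical
  obtain ⟨h1, P, hP, hP'⟩ := hJ
  obtain ⟨h2, Q, hQ, hQ'⟩ := hK
  refine ⟨h1.union h2, P ∪ Q, by simp [hP, hQ], ?_⟩
  rw [Finset.coe_union]
  exact (frontier_union_subset _ _).trans (union_subset_union
    (inter_subset_left.trans hP') (inter_subset_right.trans hQ'))

theorem IsSlowSet.inter {J K : Set ℝ} (hJ : F.IsSlowSet J) (hK : F.IsSlowSet K) :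
    F.IsSlowSet (J ∩ K) := by
  simpa [Set.compl_union] using (hJ.compl.union hK.compl).compl

theorem IsSlowSet.diff {J K : Set ℝ} (hJ : F.IsSlowSet J) (hK : F.IsSlowSet K) :
    F.IsSlowSet (J \ K) := by
  rw [sdiff_eq]
  exact hJ.inter hK.compl

theorem isSlowSet_empty : F.IsSlowSet ∅ :=
  ⟨@MeasurableSet.empty _ F.slowSigma, ∅, by simp, by simp⟩

theorem slowInterval_measurable {J : Set ℝ} (hJ : J ∈ F.slowIntervals) :
    MeasurableSet[F.slowSigma] J :=
  MeasurableSpace.measurableSet_generateFrom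
    ⟨{J}, finite_singleton J, by simpa using hJ, by simp⟩

theorem isSlowSet_Iio {x : ℝ} (hx : x ∈ F.slowPoints) : F.IsSlowSet (Iio x) :=
  ⟨slowInterval_measurable ⟨x, hx, x, hx, by simp⟩, {x}, by simpa using hx, by simp⟩

theorem isSlowSet_Iic {x : ℝ} (hx : x ∈ F.slowPoints) : F.IsSlowSet (Iic x) :=
  ⟨slowInterval_measurable ⟨x, hx, x, hx, by simp⟩, {x}, by simpa using hx, by simp⟩

theorem isSlowSet_Icc {x y : ℝ} (hx : x ∈ F.slowPoints) (hy : y ∈ F.slowPoints) :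
    F.IsSlowSet (Icc x y) := by
  rw [← Ici_inter_Iic, ← compl_Iio]
  exact (isSlowSet_Iio hx).compl.inter (isSlowSet_Iic hy)

theorem isSlowSet_uIcc {x y : ℝ} (hx : x ∈ F.slowPoints) (hy : y ∈ F.slowPoints) :
    F.IsSlowSet (uIcc x y) := by
  rcases le_total x y with h | h
  · rw [uIcc_of_le h]; exact isSlowSet_Icc hx hy
  · rw [uIcc_of_ge h]; exact isSlowSet_Icc hy hx

/-- A property of sets that holds for the half-lines with slow endpoints and is stable under
Boolean operations holds for all slow intervals. -/
theorem slowIntervals_induction {p : Set ℝ → Prop} (hIio : ∀ x ∈ F.slowPoints, p (Iio x))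
    (hIic : ∀ x ∈ F.slowPoints, p (Iic x)) (hc : ∀ J, p J → p Jᶜ)
    (hi : ∀ J K, p J → p K → p (J ∩ K)) {J : Set ℝ} (hJ : J ∈ F.slowIntervals) : p J := by
  have hIoi : ∀ x ∈ F.slowPoints, p (Ioi x) := fun x hx => compl_Iic (a := x) ▸ hc _ (hIic x hx)
  have hIci : ∀ x ∈ F.slowPoints, p (Ici x) := fun x hx => compl_Iio (a := x) ▸ hc _ (hIio x hx)
  obtain ⟨x, hx, y, hy, h⟩ := hJ
  rcases h with rfl | rfl | rfl | rfl | rfl | rfl | rfl | rfl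
  · exact hIio x hx
  · exact hIic x hx
  · exact hi _ _ (hIoi x hx) (hIio y hy)
  · exact hi _ _ (hIci x hx) (hIio y hy)
  · exact hi _ _ (hIoi x hx) (hIic y hy)
  · exact hi _ _ (hIci x hx) (hIic y hy)
  · exact hIci x hx
  · exact hIoi x hx

theorem isSlowSet_of_mem_slowAlgebra {J : Set ℝ} (hJ : J ∈ F.slowAlgebra) : F.IsSlowSet J := by
  obtain ⟨T, hT, hsub, rfl⟩ := hJ
  induction T, hT using Set.Finite.induction_on with
  | empty => simpa using isSlowSet_empty
  | insert _ _ ih =>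
    rw [sUnion_insert]
    refine IsSlowSet.union ?_ (ih ((subset_insert _ _).trans hsub))
    exact slowIntervals_induction (fun x => isSlowSet_Iio) (fun x => isSlowSet_Iic)
      (fun _ => IsSlowSet.compl) (fun _ _ => IsSlowSet.inter) (hsub (mem_insert _ _))

variable (F) in
/-- The half-lines with slow endpoints that are unbounded to the left. They form a chain. -/
def slowRays : Set (Set ℝ) := {J | ∃ x ∈ F.slowPoints, J = Iio x ∨ J = Iic x}

theorem isPiSystem_slowRays : IsPiSystem F.slowRays := by
  have hchain : ∀ J ∈ F.slowRays, ∀ K ∈ F.slowRays, J ⊆ K ∨ K ⊆ J := by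
    intro J hJ K hK
    refine IsLowerSet.total ?_ ?_
    · obtain ⟨x, -, rfl | rfl⟩ := hJ
      exacts [isLowerSet_Iio x, isLowerSet_Iic x]
    · obtain ⟨x, -, rfl | rfl⟩ := hK
      exacts [isLowerSet_Iio x, isLowerSet_Iic x]
  intro J hJ K hK _
  rcases hchain J hJ K hK with h | h
  · rwa [inter_eq_self_of_subset_left h]
  · rwa [inter_eq_self_of_subset_right h]

theorem slowSigma_eq : F.slowSigma = MeasurableSpace.generateFrom F.slowRays := by
  apply le_antisymm
  · refine MeasurableSpace.generateFrom_le ?_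
    rintro _ ⟨T, hT, hsub, rfl⟩
    refine MeasurableSet.sUnion hT.countable fun J hJ => ?_
    refine slowIntervals_induction (p := fun J => MeasurableSet[MeasurableSpace.generateFrom
      F.slowRays] J) ?_ ?_ ?_ ?_ (hsub hJ)
    · exact fun x hx => MeasurableSpace.measurableSet_generateFrom ⟨x, hx, Or.inl rfl⟩
    · exact fun x hx => MeasurableSpace.measurableSet_generateFrom ⟨x, hx, Or.inr rfl⟩
    · exact fun _ h => h.compl
    · exact fun _ _ h h' => h.inter h'
  · refine MeasurableSpace.generateFrom_le ?_
    rintro _ ⟨x, hx, rfl | rfl⟩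
    exacts [(isSlowSet_Iio hx).1, (isSlowSet_Iic hx).1]

theorem slowSigma_le : F.slowSigma ≤ borel ℝ := by
  rw [slowSigma_eq, ← BorelSpace.measurable_eq (α := ℝ)]
  refine MeasurableSpace.generateFrom_le ?_
  rintro _ ⟨x, hx, rfl | rfl⟩
  exacts [measurableSet_Iio, measurableSet_Iic]

/-- Images of slow rays are slow sets, as images of slow points are slow. -/
theorem isSlowSet_image_of_mem_slowRays (hs : F.s₀ < F.s) {J : Set ℝ} (hJ : J ∈ F.slowRays)
    (i : Fin n) : F.IsSlowSet (F.image i J) := by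
  have hl := F.endValue_mem_slowPoints hs (i, false)
  have hr := F.endValue_mem_slowPoints hs (i, true)
  simp only [endValue, endpoint, if_true, Bool.false_eq_true, if_false] at hl hr
  obtain ⟨x, hx, hJ⟩ := hJ
  by_cases hxI : x ∈ F.I i
  · have hfx := F.apply_mem_slowPoints hs hxI hx
    rcases hJ with rfl | rfl
    · rw [F.image_Iio hxI, ← Icc_self]
      exact (isSlowSet_uIcc hl hfx).diff (isSlowSet_Icc hfx hfx)
    · rw [F.image_Iic hxI]
      exact isSlowSet_uIcc hl hfx
  rcases lt_or_ge x (F.left i) with h | h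
  · rw [F.image_of_disjoint]
    · exact isSlowSet_empty
    · rw [Set.disjoint_left]
      rintro y hy hyI
      have h1 : y ≤ x := by
        rcases hJ with rfl | rfl
        exacts [le_of_lt hy, hy]
      exact absurd (hyI.1.trans h1) (not_le.2 h)
  · rw [F.image_of_subset]
    · exact isSlowSet_uIcc hl hr
    · intro y hyI
      have h1 : y < x := lt_of_le_of_lt hyI.2 (lt_of_not_ge fun h2 => hxI ⟨h, h2⟩)
      rcases hJ with rfl | rfl
      exacts [h1, h1.le]

variable {μ : Measure ℝ} [IsFiniteMeasure μ]

/-- A slow set restricted to an interval is cut by its boundary points into pieces that are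
intervals or empty; the induction is on the number of these points. -/
theorem hasDensity_inter_Ioo (hs : F.s₀ < F.s) (hpt : ∀ p ∈ F.slowPoints, μ {p} = 0)
    (hIoo : ∀ a ∈ F.slowPoints, ∀ b ∈ F.slowPoints, a < b →
      F.HasDensity (Ioo a b) (μ.real (Ioo a b)))
    {J : Set ℝ} {P : Finset ℝ} (hP : ↑P ⊆ F.slowPoints) (hJ : frontier J ⊆ P)
    {a b : ℝ} (ha : a ∈ F.slowPoints) (hb : b ∈ F.slowPoints) (hab : a < b) :
    F.HasDensity (J ∩ Ioo a b) (μ.real (J ∩ Ioo a b)) := by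
  classical
  induction hk : (P.filter (· ∈ Ioo a b)).card using Nat.strong_induction_on generalizing a b with
  | _ k ih =>
  subst hk
  by_cases hp : ∃ p ∈ P, p ∈ Ioo a b
  · obtain ⟨p, hpP, hpI⟩ := hp
    have hps := hP hpP
    have h1 := ih _ (Finset.card_lt_card (Finset.ssubset_iff_of_subset (fun q hq => by
      rw [Finset.mem_filter] at hq ⊢
      exact ⟨hq.1, hq.2.1, hq.2.2.trans hpI.2⟩) |>.2 ⟨p, by simp [hpP, hpI.1, hpI.2], by simp⟩))
      ha hps hpI.1 rfl
    have h2 := ih _ (Finset.card_lt_card (Finset.ssubset_iff_of_subset (fun q hq => by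
      rw [Finset.mem_filter] at hq ⊢
      exact ⟨hq.1, hpI.1.trans hq.2.1, hq.2.2⟩) |>.2 ⟨p, by simp [hpP, hpI.1, hpI.2], by simp⟩))
      hps hb hpI.2 rfl
    have e1 : J ∩ Ioo a b ∩ Iio p = J ∩ Ioo a p := by
      ext z
      exact ⟨fun h => ⟨h.1.1, h.1.2.1, h.2⟩, fun h => ⟨⟨h.1, h.2.1, h.2.2.trans hpI.2⟩, h.2.2⟩⟩
    have e2 : J ∩ Ioo a b ∩ Ioi p = J ∩ Ioo p b := by
      ext z
      exact ⟨fun h => ⟨h.1.1, h.2, h.1.2.2⟩, fun h => ⟨⟨h.1, hpI.1.trans h.2.1, h.2.2⟩, h.2.1⟩⟩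
    have hμ : μ.real (J ∩ Ioo a b) = μ.real (J ∩ Ioo a p) + μ.real (J ∩ Ioo p b) := by
      rw [← e1, ← e2, ← measureReal_inter_add_sdiff (s := J ∩ Ioo a b) (t := Iio p)
        measurableSet_Iio]
      congr 1
      refine measureReal_congr ?_
      have hne : ∀ᵐ z ∂μ, z ≠ p := by
        rw [ae_iff]
        simpa using hpt p hps
      filter_upwards [hne] with z hz
      refine propext ⟨fun h => ⟨h.1, lt_of_le_of_ne (not_lt.1 h.2) (Ne.symm hz)⟩,
        fun h => ⟨h.1, not_lt.2 (mem_Ioi.1 h.2).le⟩⟩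
    rw [hμ]
    rw [← e1] at h1 ⊢
    rw [← e2] at h2 ⊢
    exact h1.split hs hps h2
  · have hdisj : Disjoint (Ioo a b) (frontier J) :=
      Set.disjoint_left.2 fun z hz hzJ => hp ⟨z, hJ hzJ, hz⟩
    rcases isPreconnected_Ioo.subset_or_disjoint_of_frontier hdisj with h | h
    · rw [inter_eq_self_of_subset_right h]
      exact hIoo a ha b hb hab
    · rw [inter_comm, h.inter_eq, measureReal_empty]
      exact hasDensity_empty

/-- Existence of a Borel measure giving slow sets their density. -/
theorem exists_measure (hs : F.s₀ < F.s) : ∃ μ : Measure ℝ, IsFiniteMeasure μ ∧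
    ∀ J, F.IsSlowSet J → F.HasDensity J (μ.real J) := by
  have hs0 := F.s_pos hs
  obtain ⟨a, ha, b, hb, hab, hI⟩ := F.exists_bounds hs0
  set S := (monotone_dist hs0).stieltjesFunction with hS
  have hfin : IsFiniteMeasure S.measure := by
    refine S.isFiniteMeasure_of_forall_abs_le (C := 1) fun x => ?_
    rw [hS, Monotone.stieltjesFunction_eq, abs_le]
    have h1 := (monotone_dist hs0).le_rightLim (le_refl x)
    have h2 := (monotone_dist hs0).rightLim_le (lt_add_one x)
    exact ⟨(abs_le.1 (abs_dist_le hs0 x)).1.trans h1,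
      h2.trans (abs_le.1 (abs_dist_le hs0 (x + 1))).2⟩
  have hpt : ∀ p ∈ F.slowPoints, S.measure {p} = 0 := fun p hp => by
    rw [StieltjesFunction.measure_singleton, hS, stieltjes_eq hs hp, leftLim_stieltjes_eq hs hp,
      sub_self, ENNReal.ofReal_zero]
  have hIoo : ∀ a ∈ F.slowPoints, ∀ b ∈ F.slowPoints, a < b →
      F.HasDensity (Ioo a b) (S.measure.real (Ioo a b)) := fun a ha b hb hab => by
    rw [measureReal_def, StieltjesFunction.measure_Ioo, hS, stieltjes_eq hs ha,
      leftLim_stieltjes_eq hs hb, ENNReal.toReal_ofReal (sub_nonneg.2 (monotone_dist hs0 hab.le))]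
    exact hasDensity_Ioo hs ha hab (hasDensity_Iio hs ha) (hasDensity_Iio hs hb)
  refine ⟨S.measure.restrict (Ioo a b), inferInstance, fun J hJ => ?_⟩
  obtain ⟨-, P, hP, hJP⟩ := hJ
  rw [measureReal_def, Measure.restrict_apply' measurableSet_Ioo, ← measureReal_def]
  exact (hasDensity_inter_Ioo hs hpt hIoo hP hJP ha hb hab).congr (F.lap_succ_inter hI)

theorem image_compl_union (i : Fin n) (J : Set ℝ) :
    F.image i J ∪ F.image i Jᶜ = F.image i univ := by
  rw [image, image, image, ← image_union, ← union_inter_distrib_right, union_compl_self]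

theorem disjoint_image {J K : Set ℝ} (h : Disjoint J K) (i : Fin n) :
    Disjoint (F.image i J) (F.image i K) := by
  rw [Set.disjoint_left]
  rintro _ ⟨x, hx, rfl⟩ ⟨y, hy, e⟩
  rw [F.injOn i hy.2 hx.2 e] at hy
  exact Set.disjoint_left.1 h hx.1 hy.1

theorem isSlowSet_image_univ (hs : F.s₀ < F.s) (i : Fin n) : F.IsSlowSet (F.image i univ) := by
  rw [F.image_of_subset (subset_univ _)]
  exact isSlowSet_uIcc (F.endValue_mem_slowPoints hs (i, false))
    (F.endValue_mem_slowPoints hs (i, true))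

/-- The scaling relation, first for slow sets and then on the generated σ-algebra. -/
theorem measurable_image_and_scaling (hs : F.s₀ < F.s)
    (hμ : ∀ J, F.IsSlowSet J → F.HasDensity J (μ.real J)) {J : Set ℝ}
    (hJ : MeasurableSet[F.slowSigma] J) : (∀ i, MeasurableSet[F.slowSigma] (F.image i J)) ∧
      ENNReal.ofReal F.s * μ J = ∑ i, μ (F.image i J) := by
  have hs0 := F.s_pos hs
  have hle : F.slowSigma ≤ borel ℝ := slowSigma_le
  rw [← BorelSpace.measurable_eq (α := ℝ)] at hle
  have hslow : ∀ K, F.IsSlowSet K → (∀ i, F.IsSlowSet (F.image i K)) →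
      ENNReal.ofReal F.s * μ K = ∑ i, μ (F.image i K) := by
    intro K hK hKi
    have h1 := (hμ K hK).unique hs0 (hasDensity_of_image hs fun i => hμ _ (hKi i))
    rw [one_div, eq_inv_mul_iff_mul_eq₀ hs0.ne'] at h1
    rw [← ENNReal.toReal_eq_toReal_iff' (ENNReal.mul_ne_top ENNReal.ofReal_ne_top
      (measure_ne_top μ _)) (ENNReal.sum_ne_top.2 fun i _ => measure_ne_top μ _),
      ENNReal.toReal_mul, ENNReal.toReal_ofReal hs0.le,
      ENNReal.toReal_sum fun i _ => measure_ne_top μ _]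
    exact h1
  have huniv : F.IsSlowSet univ := by simpa using (isSlowSet_empty (F := F)).compl
  refine MeasurableSpace.induction_on_inter (m := F.slowSigma)
    (C := fun J _ => (∀ i, MeasurableSet[F.slowSigma] (F.image i J)) ∧
      ENNReal.ofReal F.s * μ J = ∑ i, μ (F.image i J))
    slowSigma_eq isPiSystem_slowRays ?_ ?_ ?_ ?_ J hJ
  · have h : ∀ i, F.image i ∅ = ∅ := fun i => by simp [image]
    simp [h]
  · intro K hK
    have hi := isSlowSet_image_of_mem_slowRays hs hK
    refine ⟨fun i => (hi i).1, hslow K ?_ hi⟩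
    obtain ⟨x, hx, rfl | rfl⟩ := hK
    exacts [isSlowSet_Iio hx, isSlowSet_Iic hx]
  · intro K hK ⟨h1, h2⟩
    have hi : ∀ i, MeasurableSet[F.slowSigma] (F.image i Kᶜ) := by
      intro i
      have h3 : F.image i Kᶜ = F.image i univ \ F.image i K := by
        rw [← image_compl_union i K, Set.union_sdiff_cancel_left]
        exact (disjoint_image disjoint_compl_right i).le_bot
      rw [h3]
      exact (isSlowSet_image_univ hs i).1.diff (h1 i)
    refine ⟨hi, ?_⟩
    have h3 : ∀ i, μ (F.image i K) + μ (F.image i Kᶜ) = μ (F.image i univ) := fun i => by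
      rw [← image_compl_union i K,
        measure_union (disjoint_image disjoint_compl_right i) (hle _ (hi i))]
    have h4 := hslow univ huniv (isSlowSet_image_univ hs)
    rw [← measure_add_measure_compl (hle _ hK), ← Finset.sum_congr rfl fun i _ => h3 i,
      Finset.sum_add_distrib, mul_add, h2] at h4
    exact (ENNReal.add_right_inj (ENNReal.sum_ne_top.2 fun i _ => measure_ne_top μ _)).1 h4
  · intro f hd hf h
    have him : ∀ i, F.image i (⋃ k, f k) = ⋃ k, F.image i (f k) := fun i => by
      simp only [image, iUnion_inter, image_iUnion]
    refine ⟨fun i => ?_, ?_⟩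
    · rw [him]
      exact MeasurableSet.iUnion fun k => (h k).1 i
    · rw [measure_iUnion hd fun k => hle _ (hf k), ← ENNReal.tsum_mul_left]
      simp only [him, fun k => (h k).2]
      rw [Summable.tsum_finsetSum fun i _ => ENNReal.summable]
      refine Finset.sum_congr rfl fun i _ => ?_
      rw [measure_iUnion (fun k l hkl => disjoint_image (hd hkl) i) fun k => hle _ ((h k).1 i)]

end MonotoneSystem

end

theorem theorem4 {n : ℕ} (F : MonotoneSystem n) (hs : F.s₀ < F.s) :
    ∃ Λ : @Measure ℝ F.slowSigma,
      Λ univ < ⊤ ∧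
      (∀ J : Set ℝ, MeasurableSet[F.slowSigma] J →
        (∀ i, MeasurableSet[F.slowSigma] (F.image i J)) ∧
        (Λ J).toReal = (1 / F.s) * ∑ i, (Λ (F.image i J)).toReal) ∧
      (∀ J ∈ F.slowAlgebra,
        Tendsto (fun t : ℂ => F.L J t / F.L univ t)
          (𝓝[Metric.ball (0 : ℂ) (1 / F.s)] ((1 / F.s : ℝ) : ℂ))
          (𝓝 (((Λ J).toReal : ℝ) : ℂ))) := by
  have hs0 := F.s_pos hs
  have hle : F.slowSigma ≤ borel ℝ := MonotoneSystem.slowSigma_le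
  rw [← BorelSpace.measurable_eq (α := ℝ)] at hle
  obtain ⟨μ, hfin, hμ⟩ := MonotoneSystem.exists_measure hs
  refine ⟨μ.trim hle, ?_, fun J hJ => ?_, fun J hJ => ?_⟩
  · rw [trim_measurableSet_eq hle (@MeasurableSet.univ _ F.slowSigma)]
    exact measure_lt_top μ _
  · obtain ⟨h1, h2⟩ := MonotoneSystem.measurable_image_and_scaling hs hμ hJ
    refine ⟨h1, ?_⟩
    rw [trim_measurableSet_eq hle hJ, one_div, eq_inv_mul_iff_mul_eq₀ hs0.ne']
    rw [Finset.sum_congr rfl fun i _ => by rw [trim_measurableSet_eq hle (h1 i)]]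
    have := congrArg ENNReal.toReal h2
    rwa [ENNReal.toReal_mul, ENNReal.toReal_ofReal hs0.le,
      ENNReal.toReal_sum fun i _ => measure_ne_top μ _] at this
  · have hJ' := MonotoneSystem.isSlowSet_of_mem_slowAlgebra hJ
    rw [trim_measurableSet_eq hle hJ'.1]
    exact hμ J hJ'
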